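/- Let $G$ be a $3$-dimensional Lie group with a left-invariant semi-Riemannian (Riemannian or Lorentzian) metric $\langle\cdot,\cdot\rangle$ which is a unimodular metric Lie group of diagonalizable type: there are a left-invariant orthonormal frame $\{E_1,E_2,E_3\}$, signs $\epsilon_i=\langle E_i,E_i\rangle\in\{-1,1\}$ and constants $c_1,c_2,c_3\in\mathbb R$ with $$[E_1,E_2]=c_3E_3,\qquad [E_2,E_3]=c_1E_1,\qquad [E_3,E_1]=c_2E_2 .$$ Assume that $G$ does not have constant sectional curvature. All surfaces are smooth and connected; an immersed surface is nondegenerate if its induced metric is nondegenerate (i.e. the surface is Riemannian or Lorentzian with the induced metric), and it is totally geodesic if its second fundamental form vanishes. An integral surface of a left-invariant plane distribution is an immersed surface whose tangent plane at every point is that of the distribution. For a permutation $\sigma$ of $\{1,2,3\}$ (a relabeling of the indices) consider the condition $$(C_\sigma)\qquad \epsilon_{\sigma(3)}c_{\sigma(3)}=\epsilon_{\sigma(1)}c_{\sigma(1)}+\epsilon_{\sigma(2)}c_{\sigma(2)},\qquad c_{\sigma(2)}>0>c_{\sigma(1)},$$ and, when it holds, the distributions $$\Delta_\sigma^{\pm}=\operatorname{span}\bigl\{\sqrt{-c_{\sigma(1)}}\,E_{\sigma(1)}\pm\sqrt{c_{\sigma(2)}}\,E_{\sigma(2)},\;E_{\sigma(3)}\bigr\}.$$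 Then: 1. There is a nondegenerate totally geodesic immersed surface in $G$ if and only if some $\sigma$ satisfies $(C_\sigma)$ and $\epsilon_{\sigma(1)}c_{\sigma(1)}\neq\epsilon_{\sigma(2)}c_{\sigma(2)}$. (Given $(C_\sigma)$, the last condition says that the planes of $\Delta_\sigma^{\pm}$ are nondegenerate; it is automatic if $\epsilon_{\sigma(1)}=\epsilon_{\sigma(2)}$, in particular in the Riemannian case.) 2. A nondegenerate immersed surface in $G$ is totally geodesic if and only if there is $\sigma$ satisfying $(C_\sigma)$ such that the surface is an integral surface of $\Delta_\sigma^{+}$ or an integral surface of $\Delta_\sigma^{-}$. 3. If $\sigma$ is any permutation satisfying $(C_\sigma)$, then a nondegenerate immersed surface in $G$ is totally geodesic if and only if it is an integral surface of $\Delta_\sigma^{+}$ or of $\Delta_\sigma^{-}$; moreover both distributions are integrable: through every point of $G$ passes an integral surface of each of them. -/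

import Mathlib

universe u w

open Set Filter Topology
open scoped Manifold ContDiff

noncomputable section

/-! ### Levi-Civita connection and curvature of a left-invariant metric, on left-invariant fields -/

namespace MetricLie

section Algebra

variable {L : Type*} [LieRing L] [LieAlgebra ℝ L] [FiniteDimensional ℝ L]

/-- The right-hand side of the Koszul formula for left-invariant vector fields:
`⟨∇_X Y, Z⟩ = (⟨[X,Y],Z⟩ - ⟨[Y,Z],X⟩ + ⟨[Z,X],Y⟩) / 2`, as a linear form in `Z`. -/
def koszul (B : LinearMap.BilinForm ℝ L) (X Y : L) : Module.Dual ℝ L where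
  toFun Z := (B ⁅X, Y⁆ Z - B ⁅Y, Z⁆ X + B ⁅Z, X⁆ Y) / 2
  map_add' Z W := by simp only [lie_add, add_lie, map_add, LinearMap.add_apply]; ring
  map_smul' r Z := by
    simp only [lie_smul, smul_lie, map_smul, LinearMap.smul_apply, smul_eq_mul, RingHom.id_apply]
    ring

/-- The Levi-Civita connection `∇_X Y` of the left-invariant metric `B`, for left-invariant vector
fields `X, Y`: the vector that represents the Koszul form with respect to `B`. -/
def leviCivita (B : LinearMap.BilinForm ℝ L) (hB : B.Nondegenerate) (X Y : L) : L :=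
  (B.toDual hB).symm (koszul B X Y)

theorem apply_leviCivita (B : LinearMap.BilinForm ℝ L) (hB : B.Nondegenerate) (X Y Z : L) :
    B (leviCivita B hB X Y) Z = (B ⁅X, Y⁆ Z - B ⁅Y, Z⁆ X + B ⁅Z, X⁆ Y) / 2 := by
  simp [leviCivita, koszul, LinearMap.BilinForm.apply_toDual_symm_apply]

/-- The connection is compatible with the metric. -/
theorem leviCivita_metric (B : LinearMap.BilinForm ℝ L) (hB : B.Nondegenerate) (hs : B.IsSymm)
    (X Y Z : L) : B (leviCivita B hB X Y) Z + B Y (leviCivita B hB X Z) = 0 := by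
  rw [hs.eq Y, apply_leviCivita, apply_leviCivita, ← lie_skew X Y, ← lie_skew Z Y, ← lie_skew X Z]
  simp only [map_neg, LinearMap.neg_apply]
  ring

/-- The connection is torsion-free. -/
theorem leviCivita_torsion (B : LinearMap.BilinForm ℝ L) (hB : B.Nondegenerate)
    (X Y : L) : leviCivita B hB X Y - leviCivita B hB Y X = ⁅X, Y⁆ := by
  apply (B.toDual hB).injective
  ext Z
  simp only [LinearMap.BilinForm.toDual_def, map_sub, LinearMap.sub_apply, apply_leviCivita]
  rw [← lie_skew Y X, ← lie_skew Z Y, ← lie_skew Z X]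
  simp only [map_neg, LinearMap.neg_apply]
  ring

/-- The curvature tensor `R(X,Y)Z = ∇_X ∇_Y Z - ∇_Y ∇_X Z - ∇_{[X,Y]} Z`. -/
def curvature (B : LinearMap.BilinForm ℝ L) (hB : B.Nondegenerate) (X Y Z : L) : L :=
  leviCivita B hB X (leviCivita B hB Y Z) - leviCivita B hB Y (leviCivita B hB X Z)
    - leviCivita B hB ⁅X, Y⁆ Z

end Algebra

/-! ### Three-dimensional Lie groups with a left-invariant metric -/

section Group

variable {G : Type*} [TopologicalSpace G] [ChartedSpace (EuclideanSpace ℝ (Fin 3)) G] [Group G]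

variable (G) in
/-- The Lie algebra of `G`: its tangent space at the identity, with Mathlib's bracket (that of the
associated left-invariant vector fields). -/
abbrev LieAlg : Type _ := GroupLieAlgebra (𝓡 3) G

instance : FiniteDimensional ℝ (LieAlg G) :=
  inferInstanceAs (FiniteDimensional ℝ (EuclideanSpace ℝ (Fin 3)))

instance [LieGroup (𝓡 3) ∞ G] : LieGroup (𝓡 3) (minSmoothness ℝ 3) G := by
  rw [minSmoothness_of_isRCLikeNormedField]; infer_instance

variable (G) in
/-- A left-invariant semi-Riemannian metric on `G`, given by its value at the identity. -/
structure LeftInvariantMetric where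
  form : LinearMap.BilinForm ℝ (LieAlg G)
  symm : form.IsSymm
  nondegenerate : form.Nondegenerate

/-- `E` is a left-invariant orthonormal frame with signs `⟨E i, E i⟩ = ε i` and structure
constants `c`: `[E₁,E₂] = c₃E₃`, `[E₂,E₃] = c₁E₁`, `[E₃,E₁] = c₂E₂` (indices `0, 1, 2` here). -/
structure IsDiagonalFrame (m : LeftInvariantMetric G) (E : Module.Basis (Fin 3) ℝ (LieAlg G))
    (ε c : Fin 3 → ℝ) : Prop where
  sign : ∀ i, ε i = 1 ∨ ε i = -1
  norm : ∀ i, m.form (E i) (E i) = ε i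
  orthogonal : ∀ i j, i ≠ j → m.form (E i) (E j) = 0
  bracket_zero_one : ⁅E 0, E 1⁆ = c 2 • E 2
  bracket_one_two : ⁅E 1, E 2⁆ = c 0 • E 0
  bracket_two_zero : ⁅E 2, E 0⁆ = c 1 • E 1

/-- All nondegenerate tangent planes have the same sectional curvature
`⟨R(X,Y)Y, X⟩ / (⟨X,X⟩⟨Y,Y⟩ - ⟨X,Y⟩²)`; planes at the identity suffice, by left invariance. -/
def HasConstantSectionalCurvature [LieGroup (𝓡 3) ∞ G] (m : LeftInvariantMetric G) : Prop :=
  ∃ κ : ℝ, ∀ X Y : LieAlg G, m.form X X * m.form Y Y - m.form X Y ^ 2 ≠ 0 →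
    m.form (curvature m.form m.nondegenerate X Y Y) X
      / (m.form X X * m.form Y Y - m.form X Y ^ 2) = κ

/-- The left-trivialization `T_g G → T_1 G`, the differential at `g` of `h ↦ g⁻¹ h`. It takes the
value at `g` of a left-invariant vector field to its value at the identity. -/
def leftTriv (g : G) : TangentSpace (𝓡 3) g →L[ℝ] LieAlg G :=
  mfderiv (𝓡 3) (𝓡 3) (fun h : G => g⁻¹ * h) g

end Group

/-! ### Surfaces -/

/-- Connected smooth surfaces (Hausdorff, second countable, without boundary). -/
structure Surface where
  carrier : Type*
  [topology : TopologicalSpace carrier]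
  [charted : ChartedSpace (EuclideanSpace ℝ (Fin 2)) carrier]
  [smooth : IsManifold (𝓡 2) ∞ carrier]
  [hausdorff : T2Space carrier]
  [secondCountable : SecondCountableTopology carrier]
  [connected : ConnectedSpace carrier]

attribute [instance] Surface.topology Surface.charted Surface.smooth Surface.hausdorff
  Surface.secondCountable Surface.connected

section Immersions

variable {G : Type*} [TopologicalSpace G] [ChartedSpace (EuclideanSpace ℝ (Fin 3)) G] [Group G]
variable {S : Surface}

/-- The differential of `φ : S → G` at `p`, followed by the left-trivialization of `T_{φ(p)} G`. -/
def leftDiff (φ : S.carrier → G) (p : S.carrier) : TangentSpace (𝓡 2) p →L[ℝ] LieAlg G :=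
  (leftTriv (φ p)).comp (mfderiv (𝓡 2) (𝓡 3) φ p)

/-- The left-translate to the identity of the tangent plane `dφ_p(T_p S)`. -/
def tangentPlane (φ : S.carrier → G) (p : S.carrier) : Submodule ℝ (LieAlg G) :=
  LinearMap.range (leftDiff φ p : TangentSpace (𝓡 2) p →ₗ[ℝ] LieAlg G)

/-- `φ` is a smooth immersion. -/
structure IsImmersion (φ : S.carrier → G) : Prop where
  contMDiff : ContMDiff (𝓡 2) (𝓡 3) ∞ φ
  injective : ∀ p, Function.Injective (mfderiv (𝓡 2) (𝓡 3) φ p)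

/-- `φ` is an immersion whose induced metric is nondegenerate. (An isometric immersion of a
surface with a nondegenerate metric is exactly such a map, the metric being the induced one.) -/
structure IsNondegenerateImmersion (m : LeftInvariantMetric G) (φ : S.carrier → G) : Prop
    extends IsImmersion φ where
  nondegenerate : ∀ (p : S.carrier) (v : TangentSpace (𝓡 2) p),
    (∀ w : TangentSpace (𝓡 2) p, m.form (leftDiff φ p v) (leftDiff φ p w) = 0) → v = 0

/-- The covariant derivative at `p`, in the direction `w ∈ T_p S`, of the vector field
`∑ i, f i • E i` along `φ : S → G`, for a left-invariant frame `E`. This is the Levi-Civita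
connection of `G` pulled back along `φ`: `∑ i, (df_i(w) E_i + f_i ∇_{dφ(w)} E_i)`. -/
def covDeriv [LieGroup (𝓡 3) ∞ G] (m : LeftInvariantMetric G)
    (E : Module.Basis (Fin 3) ℝ (LieAlg G)) (φ : S.carrier → G) (f : Fin 3 → S.carrier → ℝ)
    (p : S.carrier) (w : TangentSpace (𝓡 2) p) : LieAlg G :=
  ∑ i, (mvfderiv (𝓡 2) (f i) p w • E i
    + f i p • leviCivita m.form m.nondegenerate (leftDiff φ p w) (E i))

/-- The second fundamental form of `φ` vanishes: near any point, the ambient covariant derivative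
of a smooth tangent vector field, in any tangent direction, is tangent to the surface. Vector
fields along `φ` are written in a left-invariant frame `E`, whose choice is immaterial. -/
def IsTotallyGeodesic [LieGroup (𝓡 3) ∞ G] (m : LeftInvariantMetric G)
    (E : Module.Basis (Fin 3) ℝ (LieAlg G)) (φ : S.carrier → G) : Prop :=
  ∀ (p : S.carrier) (f : Fin 3 → S.carrier → ℝ),
    (∀ i, ContMDiffAt (𝓡 2) 𝓘(ℝ, ℝ) ∞ (f i) p) →
    (∀ᶠ q in 𝓝 p, ∑ i, f i q • E i ∈ tangentPlane φ q) →
    ∀ w : TangentSpace (𝓡 2) p, covDeriv m E φ f p w ∈ tangentPlane φ p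

/-- `φ` is an integral surface of the left-invariant distribution with value `D` at the identity:
an immersed surface whose tangent plane at each point is that of the distribution. -/
structure IsIntegralSurface (D : Submodule ℝ (LieAlg G)) (φ : S.carrier → G) : Prop
    extends IsImmersion φ where
  tangentPlane_eq : ∀ p, tangentPlane φ p = D

end Immersions

/-! ### The conditions and the distributions of the theorem -/

/-- `ε₃c₃ = ε₁c₁ + ε₂c₂`, `c₂ > 0` and `c₁ < 0`, after the relabeling `σ` of the indices. -/
def Condition (ε c : Fin 3 → ℝ) (σ : Equiv.Perm (Fin 3)) : Prop :=
  ε (σ 2) * c (σ 2) = ε (σ 0) * c (σ 0) + ε (σ 1) * c (σ 1) ∧ 0 < c (σ 1) ∧ c (σ 0) < 0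

/-- The plane spanned by `√(-c₁) E₁ + s √c₂ E₂` and `E₃`, after the relabeling `σ`; used with
`s = 1` and `s = -1`. -/
def distribution {G : Type*} [TopologicalSpace G] [ChartedSpace (EuclideanSpace ℝ (Fin 3)) G]
    [Group G] (E : Module.Basis (Fin 3) ℝ (LieAlg G)) (c : Fin 3 → ℝ) (σ : Equiv.Perm (Fin 3))
    (s : ℝ) : Submodule ℝ (LieAlg G) :=
  Submodule.span ℝ {√(-c (σ 0)) • E (σ 0) + (s * √(c (σ 1))) • E (σ 1), E (σ 2)}

end MetricLie

end

/-! With indices 0, 1, 2 and μᵢ = `connCoeff`, the connection satisfies ∇_{E₀}E₁ = ε₂μ₀E₂ and its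
analogues. The curvature acts diagonally on the bivectors EᵢEⱼ, with coefficients Kᵢ = `secCoeff` up
to a common sign, so excluding constant curvature excludes K₀ = K₁ = K₂.

Let n be a normal covector of a nondegenerate totally geodesic surface. Covariant derivatives of
tangent fields are tangent, hence so is R(X,Y)Z for X, Y, Z tangent. As R is diagonal and n is not
null, this forces nᵢnⱼ(Kᵢ − Kⱼ) = 0 (`normal_mul_normal`). Since the Kᵢ are not all equal, one
component of n vanishes near each point (`exists_eventually_normal_eq_zero`); after a cyclic
relabeling it is n₂.

Then E₂ is tangent, and tangency of ∇_U E₂ for U = n₁E₀ − n₀E₁ reads ε₀μ₁n₀² + ε₁μ₀n₁² = 0. This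
leaves at most two directions for n, so by continuity the left-translated tangent plane is locally
constant. Hence the left-invariant field with value U is tangent too, and tangency of ∇_{E₂}U gives
μ₂ = 0, that is ε₂c₂ = ε₀c₀ + ε₁c₁. The quadratic equation becomes c₀n₀² + c₁n₁² = 0, so c₀ and c₁
have opposite signs and the plane is one of the two distributions
(`eventually_eq_diagPlane_of_normal_two`). Connectedness makes the plane the same everywhere.

Conversely, under the condition ∇_w maps the whole Lie algebra into Δ for every w in Δ
(`leviCivita_mem_diag`), so integral surfaces are totally geodesic. With U now the first spanning
vector of Δ, [E₂, U] is a multiple of U, and (s, t) ↦ g exp(sU) exp(tE₂) is an integral surface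
(`exists_map_mcForm_eq`). The condition determines σ because the sum of all εᵢcᵢ is twice the term
with index σ(2), and the signs of c separate the other two indices.

The link between surfaces and algebra is the pulled-back left Maurer–Cartan form Θ: its structure
equation dΘ(u,v) = −[Θu,Θv] turns the commutator of covariant derivatives along the surface into the
algebraic curvature tensor. -/

noncomputable section

namespace MetricLie

/-! ### Connection and curvature in a diagonal orthonormal basis. -/

section DiagonalAlgebra

variable {L : Type*} [LieRing L] [LieAlgebra ℝ L]

/-- An orthonormal basis of a Lie algebra with a bilinear form, in which the bracket is diagonal:
`[E₁,E₂] = c₃E₃`, `[E₂,E₃] = c₁E₁`, `[E₃,E₁] = c₂E₂`. -/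
structure IsDiagonalBasis (B : LinearMap.BilinForm ℝ L) (E : Module.Basis (Fin 3) ℝ L)
    (ε c : Fin 3 → ℝ) : Prop where
  sign : ∀ i, ε i = 1 ∨ ε i = -1
  norm : ∀ i, B (E i) (E i) = ε i
  orthogonal : ∀ i j, i ≠ j → B (E i) (E j) = 0
  bracket_zero_one : ⁅E 0, E 1⁆ = c 2 • E 2
  bracket_one_two : ⁅E 1, E 2⁆ = c 0 • E 0
  bracket_two_zero : ⁅E 2, E 0⁆ = c 1 • E 1

/-- The connection coefficients: `∇_{E₁} E₂ = ε₃ μ₁ E₃`, and so on. -/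
def connCoeff (ε c : Fin 3 → ℝ) (i : Fin 3) : ℝ :=
  (ε 0 * c 0 + ε 1 * c 1 + ε 2 * c 2) / 2 - ε i * c i

theorem eq_sum_repr_fin_three {V : Type*} [AddCommGroup V] [Module ℝ V]
    (E : Module.Basis (Fin 3) ℝ V) (X : V) :
    X = E.repr X 0 • E 0 + E.repr X 1 • E 1 + E.repr X 2 • E 2 := by
  conv_lhs => rw [← E.sum_repr X, Fin.sum_univ_three]

theorem ext_repr_fin_three {V : Type*} [AddCommGroup V] [Module ℝ V]
    (E : Module.Basis (Fin 3) ℝ V) {X Y : V} (h0 : E.repr X 0 = E.repr Y 0)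
    (h1 : E.repr X 1 = E.repr Y 1) (h2 : E.repr X 2 = E.repr Y 2) : X = Y := by
  rw [eq_sum_repr_fin_three E X, eq_sum_repr_fin_three E Y, h0, h1, h2]

namespace IsDiagonalBasis

variable {B : LinearMap.BilinForm ℝ L} {E : Module.Basis (Fin 3) ℝ L} {ε c : Fin 3 → ℝ}

theorem sign_mul_self (h : IsDiagonalBasis B E ε c) (i : Fin 3) : ε i * ε i = 1 := by
  rcases h.sign i with h | h <;> rw [h] <;> norm_num

theorem sign_ne_zero (h : IsDiagonalBasis B E ε c) (i : Fin 3) : ε i ≠ 0 := by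
  rcases h.sign i with h | h <;> rw [h] <;> norm_num

/-- Cyclic relabeling of the basis. -/
theorem rotate (h : IsDiagonalBasis B E ε c) :
    IsDiagonalBasis B (E.reindex (finRotate 3).symm) (ε ∘ finRotate 3) (c ∘ finRotate 3) where
  sign i := h.sign _
  norm i := by simpa using h.norm _
  orthogonal i j hij := by
    simpa using h.orthogonal _ _ fun e => hij ((finRotate 3).injective e)
  bracket_zero_one := by simpa using h.bracket_one_two
  bracket_one_two := by simpa using h.bracket_two_zero
  bracket_two_zero := by simpa using h.bracket_zero_one

theorem bracket_eq (h : IsDiagonalBasis B E ε c) (X Y : L) :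
    ⁅X, Y⁆ = (c 0 * (E.repr X 1 * E.repr Y 2 - E.repr X 2 * E.repr Y 1)) • E 0 +
      (c 1 * (E.repr X 2 * E.repr Y 0 - E.repr X 0 * E.repr Y 2)) • E 1 +
      (c 2 * (E.repr X 0 * E.repr Y 1 - E.repr X 1 * E.repr Y 0)) • E 2 := by
  have h10 : ⁅E 1, E 0⁆ = -(c 2 • E 2) := by rw [← lie_skew, h.bracket_zero_one]
  have h21 : ⁅E 2, E 1⁆ = -(c 0 • E 0) := by rw [← lie_skew, h.bracket_one_two]
  have h02 : ⁅E 0, E 2⁆ = -(c 1 • E 1) := by rw [← lie_skew, h.bracket_two_zero]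
  conv_lhs => rw [eq_sum_repr_fin_three E X, eq_sum_repr_fin_three E Y]
  simp only [add_lie, lie_add, smul_lie, lie_smul, lie_self, h.bracket_zero_one,
    h.bracket_one_two, h.bracket_two_zero, h10, h21, h02]
  module

theorem form_eq (h : IsDiagonalBasis B E ε c) (X Y : L) :
    B X Y = ε 0 * E.repr X 0 * E.repr Y 0 + ε 1 * E.repr X 1 * E.repr Y 1
      + ε 2 * E.repr X 2 * E.repr Y 2 := by
  conv_lhs => rw [eq_sum_repr_fin_three E X, eq_sum_repr_fin_three E Y]
  simp only [map_add, map_smul, LinearMap.add_apply, LinearMap.smul_apply, smul_eq_mul, h.norm,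
    h.orthogonal 0 1 (by decide), h.orthogonal 0 2 (by decide), h.orthogonal 1 0 (by decide),
    h.orthogonal 1 2 (by decide), h.orthogonal 2 0 (by decide), h.orthogonal 2 1 (by decide)]
  ring

theorem repr_lie_zero (h : IsDiagonalBasis B E ε c) (X Y : L) :
    E.repr ⁅X, Y⁆ 0 = c 0 * (E.repr X 1 * E.repr Y 2 - E.repr X 2 * E.repr Y 1) := by
  simp [h.bracket_eq X Y]

theorem repr_lie_one (h : IsDiagonalBasis B E ε c) (X Y : L) :
    E.repr ⁅X, Y⁆ 1 = c 1 * (E.repr X 2 * E.repr Y 0 - E.repr X 0 * E.repr Y 2) := by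
  simp [h.bracket_eq X Y]

theorem repr_lie_two (h : IsDiagonalBasis B E ε c) (X Y : L) :
    E.repr ⁅X, Y⁆ 2 = c 2 * (E.repr X 0 * E.repr Y 1 - E.repr X 1 * E.repr Y 0) := by
  simp [h.bracket_eq X Y]

/-- Inverts the definition of the μᵢ, using εᵢ² = 1; curvature can then be written in the μᵢ alone.
-/
theorem mul_eq_connCoeff (h : IsDiagonalBasis B E ε c) :
    c 0 = ε 0 * (connCoeff ε c 1 + connCoeff ε c 2) ∧
    c 1 = ε 1 * (connCoeff ε c 2 + connCoeff ε c 0) ∧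
    c 2 = ε 2 * (connCoeff ε c 0 + connCoeff ε c 1) := by
  refine ⟨?_, ?_, ?_⟩ <;> simp only [connCoeff]
  · linear_combination (-c 0) * h.sign_mul_self 0
  · linear_combination (-c 1) * h.sign_mul_self 1
  · linear_combination (-c 2) * h.sign_mul_self 2

variable [FiniteDimensional ℝ L]

theorem leviCivita_eq (h : IsDiagonalBasis B E ε c) (hB : B.Nondegenerate) (X Y : L) :
    leviCivita B hB X Y =
      (ε 0 * (connCoeff ε c 1 * E.repr X 1 * E.repr Y 2
        - connCoeff ε c 2 * E.repr X 2 * E.repr Y 1)) • E 0 +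
      (ε 1 * (connCoeff ε c 2 * E.repr X 2 * E.repr Y 0
        - connCoeff ε c 0 * E.repr X 0 * E.repr Y 2)) • E 1 +
      (ε 2 * (connCoeff ε c 0 * E.repr X 0 * E.repr Y 1
        - connCoeff ε c 1 * E.repr X 1 * E.repr Y 0)) • E 2 := by
  apply (B.toDual hB).injective
  ext Z
  simp only [LinearMap.BilinForm.toDual_def, apply_leviCivita]
  rw [h.form_eq ⁅X, Y⁆, h.form_eq ⁅Y, Z⁆, h.form_eq ⁅Z, X⁆, h.form_eq _ Z, h.bracket_eq X Y,
    h.bracket_eq Y Z, h.bracket_eq Z X]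
  simp only [map_add, map_smul, Finsupp.add_apply, Finsupp.smul_apply, Module.Basis.repr_self,
    smul_eq_mul, Finsupp.single_apply, Fin.isValue, Fin.reduceEq, if_true, if_false, connCoeff]
  have h0 := h.sign_mul_self 0
  have h1 := h.sign_mul_self 1
  have h2 := h.sign_mul_self 2
  generalize E.repr X 0 = x0, E.repr X 1 = x1, E.repr X 2 = x2, E.repr Y 0 = y0,
    E.repr Y 1 = y1, E.repr Y 2 = y2, E.repr Z 0 = z0, E.repr Z 1 = z1, E.repr Z 2 = z2
  generalize ε 0 = e0, ε 1 = e1, ε 2 = e2 at *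
  linear_combination (norm := ring_nf)
    (-z0 * (((e0 * c 0 + e1 * c 1 + e2 * c 2) / 2 - e1 * c 1) * x1 * y2
      - ((e0 * c 0 + e1 * c 1 + e2 * c 2) / 2 - e2 * c 2) * x2 * y1)) * h0
    + (-z1 * (((e0 * c 0 + e1 * c 1 + e2 * c 2) / 2 - e2 * c 2) * x2 * y0
      - ((e0 * c 0 + e1 * c 1 + e2 * c 2) / 2 - e0 * c 0) * x0 * y2)) * h1
    + (-z2 * (((e0 * c 0 + e1 * c 1 + e2 * c 2) / 2 - e0 * c 0) * x0 * y1
      - ((e0 * c 0 + e1 * c 1 + e2 * c 2) / 2 - e1 * c 1) * x1 * y0)) * h2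

theorem repr_leviCivita_zero (h : IsDiagonalBasis B E ε c) (hB : B.Nondegenerate) (X Y : L) :
    E.repr (leviCivita B hB X Y) 0 = ε 0 * (connCoeff ε c 1 * E.repr X 1 * E.repr Y 2
        - connCoeff ε c 2 * E.repr X 2 * E.repr Y 1) := by
  simp [h.leviCivita_eq hB X Y]

theorem repr_leviCivita_one (h : IsDiagonalBasis B E ε c) (hB : B.Nondegenerate) (X Y : L) :
    E.repr (leviCivita B hB X Y) 1 = ε 1 * (connCoeff ε c 2 * E.repr X 2 * E.repr Y 0
        - connCoeff ε c 0 * E.repr X 0 * E.repr Y 2) := by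
  simp [h.leviCivita_eq hB X Y]

theorem repr_leviCivita_two (h : IsDiagonalBasis B E ε c) (hB : B.Nondegenerate) (X Y : L) :
    E.repr (leviCivita B hB X Y) 2 = ε 2 * (connCoeff ε c 0 * E.repr X 0 * E.repr Y 1
        - connCoeff ε c 1 * E.repr X 1 * E.repr Y 0) := by
  simp [h.leviCivita_eq hB X Y]

end IsDiagonalBasis

/-- The sectional curvatures of the coordinate planes, up to the common factor `ε₁ε₂ε₃`; the
index is that of the normal direction. -/
def secCoeff (ε c : Fin 3 → ℝ) (i : Fin 3) : ℝ :=
  connCoeff ε c 0 * connCoeff ε c 1 + connCoeff ε c 1 * connCoeff ε c 2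
    + connCoeff ε c 2 * connCoeff ε c 0
    - 2 * (connCoeff ε c (i + 1) * connCoeff ε c (i + 2))

namespace IsDiagonalBasis

variable {B : LinearMap.BilinForm ℝ L} {E : Module.Basis (Fin 3) ℝ L} {ε c : Fin 3 → ℝ}
variable [FiniteDimensional ℝ L]

/-- The curvature operator is diagonal on bivectors: X and Y enter only through their cross product,
whose i-th coordinate is multiplied by Kᵢ. -/
theorem repr_curvature (h : IsDiagonalBasis B E ε c) (hB : B.Nondegenerate) (X Y Z : L) :
    (E.repr (curvature B hB X Y Z) 0 =
      ε 1 * ε 2 * ε 0 * (ε 1 * secCoeff ε c 2 * (E.repr X 0 * E.repr Y 1 - E.repr X 1 * E.repr Y 0) *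
        E.repr Z 1 - ε 2 * secCoeff ε c 1 * (E.repr X 2 * E.repr Y 0 - E.repr X 0 * E.repr Y 2) *
        E.repr Z 2)) ∧
    (E.repr (curvature B hB X Y Z) 1 =
      ε 1 * ε 2 * ε 0 * (ε 2 * secCoeff ε c 0 * (E.repr X 1 * E.repr Y 2 - E.repr X 2 * E.repr Y 1) *
        E.repr Z 2 - ε 0 * secCoeff ε c 2 * (E.repr X 0 * E.repr Y 1 - E.repr X 1 * E.repr Y 0) *
        E.repr Z 0)) ∧
    (E.repr (curvature B hB X Y Z) 2 =
      ε 1 * ε 2 * ε 0 * (ε 0 * secCoeff ε c 1 * (E.repr X 2 * E.repr Y 0 - E.repr X 0 * E.repr Y 2) *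
        E.repr Z 0 - ε 1 * secCoeff ε c 0 * (E.repr X 1 * E.repr Y 2 - E.repr X 2 * E.repr Y 1) *
        E.repr Z 1)) := by
  obtain ⟨hc0, hc1, hc2⟩ := h.mul_eq_connCoeff
  simp only [curvature, map_sub, Finsupp.sub_apply, h.repr_leviCivita_zero, h.repr_leviCivita_one,
    h.repr_leviCivita_two, h.repr_lie_zero, h.repr_lie_one, h.repr_lie_two, secCoeff, Fin.isValue,
    Fin.reduceAdd, zero_add]
  rw [hc0, hc1, hc2]
  generalize E.repr X 0 = x0, E.repr X 1 = x1, E.repr X 2 = x2, E.repr Y 0 = y0,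
    E.repr Y 1 = y1, E.repr Y 2 = y2, E.repr Z 0 = z0, E.repr Z 1 = z1, E.repr Z 2 = z2
  generalize connCoeff ε c 0 = m0, connCoeff ε c 1 = m1, connCoeff ε c 2 = m2
  -- The identities hold only modulo εᵢ² = 1; for each choice of signs they are polynomial
  -- identities in the μᵢ and the coordinates.
  rcases h.sign 0 with h0 | h0 <;> rcases h.sign 1 with h1 | h1 <;> rcases h.sign 2 with h2 | h2 <;>
    rw [h0, h1, h2] <;> refine ⟨?_, ?_, ?_⟩ <;> ring

end IsDiagonalBasis
end DiagonalAlgebra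
-- Algebraic classification of totally geodesic plane fields.
section DiagonalAlgebra

variable {L : Type*} [LieRing L] [LieAlgebra ℝ L]
  {B : LinearMap.BilinForm ℝ L} {E : Module.Basis (Fin 3) ℝ L} {ε c : Fin 3 → ℝ}

/-- The covector with coordinates `n` in the basis `E` is a normal of the plane `T`. -/
def IsNormal (E : Module.Basis (Fin 3) ℝ L) (T : Submodule ℝ L) (n : Fin 3 → ℝ) : Prop :=
  n ≠ 0 ∧ ∀ z, z ∈ T ↔ n 0 * E.repr z 0 + n 1 * E.repr z 1 + n 2 * E.repr z 2 = 0

/-- The plane `span {√(-c₁) E₁ + s √c₂ E₂, E₃}`, after the relabeling `σ`. -/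
def diagPlane (E : Module.Basis (Fin 3) ℝ L) (c : Fin 3 → ℝ) (σ : Equiv.Perm (Fin 3)) (s : ℝ) :
    Submodule ℝ L :=
  Submodule.span ℝ {√(-c (σ 0)) • E (σ 0) + (s * √(c (σ 1))) • E (σ 1), E (σ 2)}

/-- The normal is the cross product of the coordinate vectors, so it depends continuously on a and
b. That it cuts out no more than the span is Cramer's rule, with a nonzero 2×2 minor as denominator.
-/
theorem isNormal_span_pair (E : Module.Basis (Fin 3) ℝ L) {a b : L}
    (hab : ∀ s t : ℝ, s • a + t • b = 0 → s = 0 ∧ t = 0) :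
    IsNormal E (Submodule.span ℝ {a, b})
      ![E.repr a 1 * E.repr b 2 - E.repr a 2 * E.repr b 1,
        E.repr a 2 * E.repr b 0 - E.repr a 0 * E.repr b 2,
        E.repr a 0 * E.repr b 1 - E.repr a 1 * E.repr b 0] := by
  have hne : ![E.repr a 1 * E.repr b 2 - E.repr a 2 * E.repr b 1,
        E.repr a 2 * E.repr b 0 - E.repr a 0 * E.repr b 2,
        E.repr a 0 * E.repr b 1 - E.repr a 1 * E.repr b 0] ≠ 0 := by
    intro h0
    have e0 := congrFun h0 0
    have e1 := congrFun h0 1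
    have e2 := congrFun h0 2
    simp only [Matrix.cons_val, Pi.zero_apply] at e0 e1 e2
    have key : ∀ i, E.repr a i = 0 := by
      intro i
      have := (hab (E.repr b i) (-E.repr a i) ?_).2
      · linarith
      · apply ext_repr_fin_three E <;>
          simp only [map_add, map_smul, Finsupp.add_apply, Finsupp.smul_apply, smul_eq_mul,
            map_zero, Finsupp.zero_apply] <;> fin_cases i <;> simp only [Fin.mk_one, Fin.zero_eta,
              Fin.reduceFinMk] <;> linarith
    have := (hab 1 0 ?_).1
    · norm_num at this
    · apply ext_repr_fin_three E <;> simp [key]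
  refine ⟨hne, fun z => ⟨fun hz => ?_, fun hz => ?_⟩⟩
  · obtain ⟨s, t, rfl⟩ := Submodule.mem_span_pair.1 hz
    simp only [Matrix.cons_val, map_add, map_smul, Finsupp.add_apply, Finsupp.smul_apply,
      smul_eq_mul]
    ring
  · simp only [Matrix.cons_val] at hz
    rw [Submodule.mem_span_pair]
    set a0 := E.repr a 0 with ha0
    set a1 := E.repr a 1 with ha1
    set a2 := E.repr a 2 with ha2
    set b0 := E.repr b 0 with hb0
    set b1 := E.repr b 1 with hb1
    set b2 := E.repr b 2 with hb2
    have h3 : a1 * b2 - a2 * b1 ≠ 0 ∨ a2 * b0 - a0 * b2 ≠ 0 ∨ a0 * b1 - a1 * b0 ≠ 0 := by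
      by_contra! hcon
      exact hne (by ext i; fin_cases i <;> simp [hcon])
    rcases h3 with h | h | h
    · refine ⟨(E.repr z 1 * b2 - E.repr z 2 * b1) / (a1 * b2 - a2 * b1),
        (a1 * E.repr z 2 - a2 * E.repr z 1) / (a1 * b2 - a2 * b1), ?_⟩
      apply ext_repr_fin_three E <;>
        simp only [map_add, map_smul, Finsupp.add_apply, Finsupp.smul_apply, smul_eq_mul,
          ← ha0, ← ha1, ← ha2, ← hb0, ← hb1, ← hb2] <;>
        rw [div_mul_eq_mul_div, div_mul_eq_mul_div, ← add_div, div_eq_iff h] <;>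
        first | ring1 | linear_combination -hz
    · refine ⟨(E.repr z 2 * b0 - E.repr z 0 * b2) / (a2 * b0 - a0 * b2),
        (a2 * E.repr z 0 - a0 * E.repr z 2) / (a2 * b0 - a0 * b2), ?_⟩
      apply ext_repr_fin_three E <;>
        simp only [map_add, map_smul, Finsupp.add_apply, Finsupp.smul_apply, smul_eq_mul,
          ← ha0, ← ha1, ← ha2, ← hb0, ← hb1, ← hb2] <;>
        rw [div_mul_eq_mul_div, div_mul_eq_mul_div, ← add_div, div_eq_iff h] <;>
        first | ring1 | linear_combination -hz
    · refine ⟨(E.repr z 0 * b1 - E.repr z 1 * b0) / (a0 * b1 - a1 * b0),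
        (a0 * E.repr z 1 - a1 * E.repr z 0) / (a0 * b1 - a1 * b0), ?_⟩
      apply ext_repr_fin_three E <;>
        simp only [map_add, map_smul, Finsupp.add_apply, Finsupp.smul_apply, smul_eq_mul,
          ← ha0, ← ha1, ← ha2, ← hb0, ← hb1, ← hb2] <;>
        rw [div_mul_eq_mul_div, div_mul_eq_mul_div, ← add_div, div_eq_iff h] <;>
        first | ring1 | linear_combination -hz

theorem repr_smul_add_smul_add_smul (E : Module.Basis (Fin 3) ℝ L) (x y z : ℝ) :
    E.repr (x • E 0 + y • E 1 + z • E 2) 0 = x ∧ E.repr (x • E 0 + y • E 1 + z • E 2) 1 = y ∧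
      E.repr (x • E 0 + y • E 1 + z • E 2) 2 = z := by
  refine ⟨?_, ?_, ?_⟩ <;> simp

theorem eq_or_eq_or_eq_perm (σ : Equiv.Perm (Fin 3)) (i : Fin 3) :
    i = σ 0 ∨ i = σ 1 ∨ i = σ 2 := by
  obtain ⟨j, rfl⟩ := σ.surjective i
  fin_cases j <;> simp

/-- The total of the εᵢcᵢ is twice the term at σ 2 and twice the term at τ 2. If τ 2 were σ 0 or σ
1, the remaining one of these two indices would have c = 0, against the strict inequalities. The
signs of c then fix the other two indices. -/
theorem Condition.unique {σ τ : Equiv.Perm (Fin 3)} (hσ : Condition ε c σ) (hτ : Condition ε c τ)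
    (hε : ∀ i, ε i ≠ 0) : σ = τ := by
  obtain ⟨h1, h2, h3⟩ := hσ
  obtain ⟨k1, k2, k3⟩ := hτ
  have hne : ∀ i, ε i * c i = 0 → c i = 0 := fun i hi => (mul_eq_zero.1 hi).resolve_left (hε i)
  have e1 := Equiv.sum_comp σ fun i => ε i * c i
  have e2 := Equiv.sum_comp τ fun i => ε i * c i
  rw [← e1, Fin.sum_univ_three, Fin.sum_univ_three] at e2
  have two : τ 2 = σ 2 := by
    rcases eq_or_eq_or_eq_perm σ (τ 2) with h | h | h
    · rw [h] at k1 e2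
      have := hne (σ 1) (by linarith)
      linarith
    · rw [h] at k1 e2
      have := hne (σ 0) (by linarith)
      linarith
    · exact h
  have zero : τ 0 = σ 0 := by
    rcases eq_or_eq_or_eq_perm σ (τ 0) with h | h | h
    · exact h
    · rw [h] at k3; linarith
    · rw [← two] at h; exact absurd (τ.injective h) (by decide)
  have one : τ 1 = σ 1 := by
    rcases eq_or_eq_or_eq_perm σ (τ 1) with h | h | h
    · rw [h] at k2; linarith
    · exact h
    · rw [← two] at h; exact absurd (τ.injective h) (by decide)
  ext i
  fin_cases i
  · simp [zero]
  · simp [one]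
  · simp [two]

/-- Both orders of (i, j) are allowed, since either of c 0 and c 1 may turn out to be the negative
one. -/
theorem eq_span_of_isNormal {T : Submodule ℝ L} {n : Fin 3 → ℝ} (hn : IsNormal E T n)
    (h2 : n 2 = 0) {i j : Fin 3} (hij : i = 0 ∧ j = 1 ∨ i = 1 ∧ j = 0) {α β : ℝ} (hα : α ≠ 0)
    (hβ : β ≠ 0) (hu : n i * α + n j * β = 0) :
    T = Submodule.span ℝ {α • E i + β • E j, E 2} := by
  have hn0 : n i ≠ 0 ∧ n j ≠ 0 := by
    constructor <;> intro h0 <;> rw [h0] at hu <;> apply hn.1 <;> ext k <;>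
      rcases hij with ⟨rfl, rfl⟩ | ⟨rfl, rfl⟩ <;> fin_cases k <;> simp_all
  have hz : ∀ z, z ∈ T ↔ n i * E.repr z i + n j * E.repr z j = 0 := by
    intro z
    rw [hn.2, h2]
    rcases hij with ⟨rfl, rfl⟩ | ⟨rfl, rfl⟩
    · rw [zero_mul, add_zero]
    · rw [zero_mul, add_zero, add_comm]
  ext z
  rw [hz, Submodule.mem_span_pair]
  constructor
  · intro h
    have h' : E.repr z j = E.repr z i / α * β := by
      field_simp
      apply mul_left_cancel₀ hn0.2
      linear_combination α * h - E.repr z i * hu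
    refine ⟨E.repr z i / α, E.repr z 2, ?_⟩
    rcases hij with ⟨rfl, rfl⟩ | ⟨rfl, rfl⟩ <;> apply ext_repr_fin_three E <;>
      simp [h', hα]
  · rintro ⟨s, t, rfl⟩
    rcases hij with ⟨rfl, rfl⟩ | ⟨rfl, rfl⟩ <;> simp <;> linear_combination s * hu

theorem IsNormal.rotate {T : Submodule ℝ L} {n : Fin 3 → ℝ} (hn : IsNormal E T n) :
    IsNormal (E.reindex (finRotate 3).symm) T (n ∘ finRotate 3) := by
  refine ⟨fun h0 => hn.1 ?_, fun z => ?_⟩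
  · ext i
    simpa using congrFun h0 ((finRotate 3).symm i)
  · rw [hn.2]
    simp only [Function.comp_apply]
    have e0 : finRotate 3 0 = 1 := by decide
    have e1 : finRotate 3 1 = 2 := by decide
    have e2 : finRotate 3 2 = 0 := by decide
    simp only [Module.Basis.repr_reindex_apply, Equiv.symm_symm, e0, e1, e2]
    constructor <;> intro h <;> linarith

theorem diagPlane_rotate (E : Module.Basis (Fin 3) ℝ L) (c : Fin 3 → ℝ) (σ : Equiv.Perm (Fin 3))
    (s : ℝ) : diagPlane (E.reindex (finRotate 3).symm) (c ∘ finRotate 3) σ s =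
      diagPlane E c (finRotate 3 * σ) s := by
  simp [diagPlane]

/-- The metric dual ∑ εᵢnᵢEᵢ of n is orthogonal to T. If n were null, this vector would also lie in
T, hence in the radical of the induced form. -/
theorem IsDiagonalBasis.normal_norm_ne_zero (h : IsDiagonalBasis B E ε c) {T : Submodule ℝ L}
    {n : Fin 3 → ℝ} (hn : IsNormal E T n) (hT : ∀ v ∈ T, (∀ w ∈ T, B v w = 0) → v = 0) :
    ε 0 * n 0 ^ 2 + ε 1 * n 1 ^ 2 + ε 2 * n 2 ^ 2 ≠ 0 := by
  intro h0
  obtain ⟨e0, e1, e2⟩ := repr_smul_add_smul_add_smul E (ε 0 * n 0) (ε 1 * n 1) (ε 2 * n 2)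
  have key := hT ((ε 0 * n 0) • E 0 + (ε 1 * n 1) • E 1 + (ε 2 * n 2) • E 2) ?_ ?_
  · rw [key] at e0 e1 e2
    apply hn.1
    ext i
    fin_cases i
    · simpa [h.sign_ne_zero 0] using e0.symm
    · simpa [h.sign_ne_zero 1] using e1.symm
    · simpa [h.sign_ne_zero 2] using e2.symm
  · rw [hn.2, e0, e1, e2]
    linear_combination h0
  · intro w hw
    rw [h.form_eq, e0, e1, e2]
    have := (hn.2 w).1 hw
    linear_combination this + n 0 * E.repr w 0 * h.sign_mul_self 0
      + n 1 * E.repr w 1 * h.sign_mul_self 1 + n 2 * E.repr w 2 * h.sign_mul_self 2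

variable [FiniteDimensional ℝ L]

/-- The sectional curvature of `B` is the constant `κ`. -/
def HasSectionalCurvature (B : LinearMap.BilinForm ℝ L) (hB : B.Nondegenerate) (κ : ℝ) : Prop :=
  ∀ X Y : L, B X X * B Y Y - B X Y ^ 2 ≠ 0 →
    B (curvature B hB X Y Y) X / (B X X * B Y Y - B X Y ^ 2) = κ

/-- With equal Kᵢ the curvature is a multiple of the Gram determinant. It is used in contrapositive
form: without constant curvature the Kᵢ are not all equal. -/
theorem IsDiagonalBasis.hasSectionalCurvature (h : IsDiagonalBasis B E ε c)
    (hB : B.Nondegenerate) (h01 : secCoeff ε c 0 = secCoeff ε c 1)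
    (h12 : secCoeff ε c 1 = secCoeff ε c 2) :
    HasSectionalCurvature B hB (ε 0 * ε 1 * ε 2 * secCoeff ε c 2) := by
  intro X Y hXY
  rw [div_eq_iff hXY, h.form_eq _ X]
  obtain ⟨e0, e1, e2⟩ := h.repr_curvature hB X Y Y
  rw [e0, e1, e2, h.form_eq X X, h.form_eq X Y, h.form_eq Y Y, h01, h12]
  generalize E.repr X 0 = x0, E.repr X 1 = x1, E.repr X 2 = x2, E.repr Y 0 = y0,
    E.repr Y 1 = y1, E.repr Y 2 = y2
  rcases h.sign 0 with h0 | h0 <;> rcases h.sign 1 with h1 | h1 <;> rcases h.sign 2 with h2 | h2 <;>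
    rw [h0, h1, h2] <;> ring

/-- Tangency of R(X,Y)Z says that the covector v with v₀ = ε₀n₁n₂(K₁ − K₂), and cyclically, vanishes
on T. So v is proportional to n. But v is also orthogonal to n for the dual metric, because the
differences K₁ − K₂, K₂ − K₀, K₀ − K₁ add up to 0. As n is not null, v = 0. -/
theorem IsDiagonalBasis.normal_mul_normal (h : IsDiagonalBasis B E ε c) (hB : B.Nondegenerate)
    {T : Submodule ℝ L} {n : Fin 3 → ℝ} (hn : IsNormal E T n)
    (hT : ∀ v ∈ T, (∀ w ∈ T, B v w = 0) → v = 0)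
    (hR : ∀ X ∈ T, ∀ Y ∈ T, ∀ Z ∈ T, curvature B hB X Y Z ∈ T) :
    n 0 * n 1 * (secCoeff ε c 0 - secCoeff ε c 1) = 0 ∧
    n 1 * n 2 * (secCoeff ε c 1 - secCoeff ε c 2) = 0 ∧
    n 2 * n 0 * (secCoeff ε c 2 - secCoeff ε c 0) = 0 := by
  have hne := h.normal_norm_ne_zero hn hT
  -- The cross products of n with the coordinate vectors are tangent, and the cross products of
  -- pairs of them are n₀n, n₁n and n₂n. Some nᵢ is nonzero, so one of these pairs spans T.
  have m0 : (0 : ℝ) • E 0 + n 2 • E 1 + (-n 1) • E 2 ∈ T := by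
    obtain ⟨e0, e1, e2⟩ := repr_smul_add_smul_add_smul E 0 (n 2) (-n 1)
    rw [hn.2, e0, e1, e2]; ring
  have m1 : (-n 2) • E 0 + (0 : ℝ) • E 1 + n 0 • E 2 ∈ T := by
    obtain ⟨e0, e1, e2⟩ := repr_smul_add_smul_add_smul E (-n 2) 0 (n 0)
    rw [hn.2, e0, e1, e2]; ring
  have m2 : n 1 • E 0 + (-n 0) • E 1 + (0 : ℝ) • E 2 ∈ T := by
    obtain ⟨e0, e1, e2⟩ := repr_smul_add_smul_add_smul E (n 1) (-n 0) 0
    rw [hn.2, e0, e1, e2]; ring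
  have hu : (ε 1 * ε 2 * ε 0) * (ε 1 * ε 2 * ε 0) = 1 := by
    linear_combination h.sign_mul_self 0 * ε 1 * ε 1 * ε 2 * ε 2 +
      h.sign_mul_self 1 * ε 2 * ε 2 + h.sign_mul_self 2
  have key : ∀ X ∈ T, ∀ Y ∈ T, ∀ Z ∈ T, ∀ r : ℝ,
      E.repr X 1 * E.repr Y 2 - E.repr X 2 * E.repr Y 1 = r * n 0 →
      E.repr X 2 * E.repr Y 0 - E.repr X 0 * E.repr Y 2 = r * n 1 →
      E.repr X 0 * E.repr Y 1 - E.repr X 1 * E.repr Y 0 = r * n 2 →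
      r * (ε 0 * n 1 * n 2 * (secCoeff ε c 1 - secCoeff ε c 2) * E.repr Z 0 +
       ε 1 * n 2 * n 0 * (secCoeff ε c 2 - secCoeff ε c 0) * E.repr Z 1 +
       ε 2 * n 0 * n 1 * (secCoeff ε c 0 - secCoeff ε c 1) * E.repr Z 2) = 0 := by
    intro X hX Y hY Z hZ r h0 h1 h2
    have := (hn.2 _).1 (hR X hX Y hY Z hZ)
    obtain ⟨e0, e1, e2⟩ := h.repr_curvature hB X Y Z
    rw [e0, e1, e2, h0, h1, h2] at this
    linear_combination (ε 1 * ε 2 * ε 0) * this - hu * r *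
      (ε 0 * n 1 * n 2 * (secCoeff ε c 1 - secCoeff ε c 2) * E.repr Z 0 +
       ε 1 * n 2 * n 0 * (secCoeff ε c 2 - secCoeff ε c 0) * E.repr Z 1 +
       ε 2 * n 0 * n 1 * (secCoeff ε c 0 - secCoeff ε c 1) * E.repr Z 2)
  obtain ⟨a0, a1, a2⟩ := repr_smul_add_smul_add_smul E 0 (n 2) (-n 1)
  obtain ⟨b0, b1, b2⟩ := repr_smul_add_smul_add_smul E (-n 2) 0 (n 0)
  obtain ⟨d0, d1, d2⟩ := repr_smul_add_smul_add_smul E (n 1) (-n 0) 0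
  have key' : ∀ Z ∈ T, ε 0 * n 1 * n 2 * (secCoeff ε c 1 - secCoeff ε c 2) * E.repr Z 0 +
       ε 1 * n 2 * n 0 * (secCoeff ε c 2 - secCoeff ε c 0) * E.repr Z 1 +
       ε 2 * n 0 * n 1 * (secCoeff ε c 0 - secCoeff ε c 1) * E.repr Z 2 = 0 := by
    intro Z hZ
    have k0 := key _ m1 _ m2 Z hZ (n 0) (by rw [b1, b2, d1, d2]; ring)
      (by rw [b0, b2, d0, d2]; ring) (by rw [b0, b1, d0, d1]; ring)
    have k1 := key _ m2 _ m0 Z hZ (n 1) (by rw [a1, a2, d1, d2]; ring)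
      (by rw [a0, a2, d0, d2]; ring) (by rw [a0, a1, d0, d1]; ring)
    have k2 := key _ m0 _ m1 Z hZ (n 2) (by rw [a1, a2, b1, b2]; ring)
      (by rw [a0, a2, b0, b2]; ring) (by rw [a0, a1, b0, b1]; ring)
    by_contra hv
    apply hn.1
    ext i
    fin_cases i
    · exact (mul_eq_zero.1 k0).resolve_right hv
    · exact (mul_eq_zero.1 k1).resolve_right hv
    · exact (mul_eq_zero.1 k2).resolve_right hv
  have k0 := key' _ m0
  have k1 := key' _ m1
  have k2 := key' _ m2
  rw [a0, a1, a2] at k0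
  rw [b0, b1, b2] at k1
  rw [d0, d1, d2] at k2
  have s0 := h.sign_mul_self 0
  have s1 := h.sign_mul_self 1
  have s2 := h.sign_mul_self 2
  set N := ε 0 * n 0 ^ 2 + ε 1 * n 1 ^ 2 + ε 2 * n 2 ^ 2 with hN
  set K0 := secCoeff ε c 0
  set K1 := secCoeff ε c 1
  set K2 := secCoeff ε c 2
  -- The relations k0, k1, k2 state that the cross product of v and n is 0. Combined with the
  -- orthogonality of v and n they give vᵢN = 0.
  have f0 : (ε 0 * n 1 * n 2 * (K1 - K2)) * N = 0 := by
    linear_combination (-ε 2 * n 2) * k1 + (ε 1 * n 1) * k2 + s0 * n 0 ^ 2 * n 1 * n 2 * (K1 - K2)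
      + s1 * n 0 ^ 2 * n 1 * n 2 * (K2 - K0) + s2 * n 0 ^ 2 * n 1 * n 2 * (K0 - K1)
  have f1 : (ε 1 * n 2 * n 0 * (K2 - K0)) * N = 0 := by
    linear_combination (ε 2 * n 2) * k0 + (-ε 0 * n 0) * k2 + s0 * n 0 * n 1 ^ 2 * n 2 * (K1 - K2)
      + s1 * n 0 * n 1 ^ 2 * n 2 * (K2 - K0) + s2 * n 0 * n 1 ^ 2 * n 2 * (K0 - K1)
  have f2 : (ε 2 * n 0 * n 1 * (K0 - K1)) * N = 0 := by
    linear_combination (-ε 1 * n 1) * k0 + (ε 0 * n 0) * k1 + s0 * n 0 * n 1 * n 2 ^ 2 * (K1 - K2)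
      + s1 * n 0 * n 1 * n 2 ^ 2 * (K2 - K0) + s2 * n 0 * n 1 * n 2 ^ 2 * (K0 - K1)
  have g0 := (mul_eq_zero.1 f0).resolve_right hne
  have g1 := (mul_eq_zero.1 f1).resolve_right hne
  have g2 := (mul_eq_zero.1 f2).resolve_right hne
  refine ⟨?_, ?_, ?_⟩
  · linear_combination ε 2 * g2 - s2 * (n 0 * n 1 * (K0 - K1))
  · linear_combination ε 0 * g0 - s0 * (n 1 * n 2 * (K1 - K2))
  · linear_combination ε 1 * g1 - s1 * (n 2 * n 0 * (K2 - K0))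

/-- The infinitesimal conditions satisfied by the field `T` of tangent planes of a nondegenerate
totally geodesic surface. -/
structure IsGeodesicPlaneField {S : Type*} [TopologicalSpace S] (B : LinearMap.BilinForm ℝ L)
    (hB : B.Nondegenerate) (T : S → Submodule ℝ L) : Prop where
  leviCivita_mem : ∀ p z, (∀ᶠ q in 𝓝 p, z ∈ T q) → ∀ w ∈ T p, leviCivita B hB w z ∈ T p
  curvature_mem : ∀ p, ∀ X ∈ T p, ∀ Y ∈ T p, ∀ Z ∈ T p, curvature B hB X Y Z ∈ T p
  nondegenerate : ∀ p, ∀ v ∈ T p, (∀ w ∈ T p, B v w = 0) → v = 0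

/-- Local form of the classification, when the normal has no component along `E₃`. -/
theorem IsDiagonalBasis.eventually_eq_diagPlane_of_normal_two {S : Type*} [TopologicalSpace S]
    {hB : B.Nondegenerate} {T : S → Submodule ℝ L}
    (h : IsDiagonalBasis B E ε c) (hK : ∀ κ, ¬ HasSectionalCurvature B hB κ)
    (hT : IsGeodesicPlaneField B hB T) {p : S} {n : S → Fin 3 → ℝ} (hc : ContinuousAt n p)
    (hn : ∀ᶠ q in 𝓝 p, IsNormal E (T q) (n q)) (h2 : ∀ᶠ q in 𝓝 p, n q 2 = 0) :
    ∃ σ, Condition ε c σ ∧ ∃ s : ℝ, (s = 1 ∨ s = -1) ∧ ∀ᶠ q in 𝓝 p, T q = diagPlane E c σ s := by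
  have hne : ∀ᶠ q in 𝓝 p, n q 0 = 0 → n q 1 ≠ 0 := by
    filter_upwards [hn, h2] with q hq hq2 h0 h1
    exact hq.1 (by ext i; fin_cases i <;> simp [h0, h1, hq2])
  have hE2 : ∀ᶠ q in 𝓝 p, E 2 ∈ T q := by
    filter_upwards [hn, h2] with q hq hq2
    rw [hq.2]; simp [hq2]
  -- Tangency of ∇_U E₂ at q, where U = n₁E₀ − n₀E₁. Only E₂ has to be tangent on a neighborhood of
  -- q; U is needed at q alone.
  have hquad : ∀ᶠ q in 𝓝 p,
      ε 0 * connCoeff ε c 1 * n q 0 ^ 2 + ε 1 * connCoeff ε c 0 * n q 1 ^ 2 = 0 := by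
    filter_upwards [hn, h2, hE2.eventually_nhds] with q hq hq2 hq3
    obtain ⟨e0, e1, e2⟩ := repr_smul_add_smul_add_smul E (n q 1) (-n q 0) 0
    have := (hq.2 _).1 (hT.leviCivita_mem q (E 2) hq3
      (n q 1 • E 0 + (-n q 0) • E 1 + (0 : ℝ) • E 2) (by rw [hq.2, e0, e1, e2, hq2]; ring))
    rw [h.repr_leviCivita_zero, h.repr_leviCivita_one, h.repr_leviCivita_two, e0, e1, e2] at this
    simp only [Module.Basis.repr_self, Finsupp.single_apply, Fin.isValue, Fin.reduceEq, if_true,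
      if_false, hq2] at this
    linear_combination -this
  -- Each product of two distinct μ's contains μᵢ or μⱼ, so if both vanish then all the K's vanish
  -- and the metric is flat.
  have hflat : ∀ i j k, i ≠ j → j ≠ k → i ≠ k →
      connCoeff ε c i = 0 → connCoeff ε c j = 0 → False := by
    intro i j k hij hjk hik hi hj
    refine hK _ (h.hasSectionalCurvature hB ?_ ?_) <;>
    fin_cases i <;> fin_cases j <;> fin_cases k <;> simp_all [secCoeff]
  have hs := fun i => h.sign_ne_zero i
  -- The quadratic equation fixes the ratio of n₀ to n₁ up to sign. If a component vanishes at p,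
  -- the equation forces it to vanish nearby; otherwise continuity keeps the sign.
  have hprop : ∀ᶠ q in 𝓝 p, n q 0 * n p 1 = n q 1 * n p 0 := by
    have hqp := hquad.self_of_nhds
    have hnp := hne.self_of_nhds
    have c0 : ContinuousAt (fun q => n q 0) p := (continuous_apply 0).continuousAt.comp hc
    have c1 : ContinuousAt (fun q => n q 1) p := (continuous_apply 1).continuousAt.comp hc
    by_cases p0 : n p 0 = 0
    · have p1 := hnp p0
      have m0 : connCoeff ε c 0 = 0 := by simpa [p0, p1, hs] using hqp
      have m1 : connCoeff ε c 1 ≠ 0 := fun m1 =>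
        hflat 0 1 2 (by decide) (by decide) (by decide) m0 m1
      filter_upwards [hquad] with q hq
      have : n q 0 = 0 := by simpa [m0, m1, hs] using hq
      rw [this, p0]; ring
    by_cases p1 : n p 1 = 0
    · have m1 : connCoeff ε c 1 = 0 := by simpa [p0, p1, hs] using hqp
      have m0 : connCoeff ε c 0 ≠ 0 := fun m0 =>
        hflat 0 1 2 (by decide) (by decide) (by decide) m0 m1
      filter_upwards [hquad] with q hq
      have : n q 1 = 0 := by simpa [m0, m1, hs] using hq
      rw [this, p1]; ring
    have m0 : connCoeff ε c 0 ≠ 0 := fun m0 => by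
      have m1 : connCoeff ε c 1 = 0 := by simpa [m0, p0, hs] using hqp
      exact hflat 0 1 2 (by decide) (by decide) (by decide) m0 m1
    have hpos : ∀ᶠ q in 𝓝 p, 0 < (n q 0 * n p 1) * (n q 1 * n p 0) := by
      have : ContinuousAt (fun q => (n q 0 * n p 1) * (n q 1 * n p 0)) p := by fun_prop
      apply this.eventually (lt_mem_nhds _)
      have : 0 < (n p 0 * n p 1) ^ 2 := by positivity
      nlinarith
    filter_upwards [hquad, hpos] with q hq hq'
    have hsq : (n q 0 * n p 1) ^ 2 = (n q 1 * n p 0) ^ 2 := by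
      have : ε 1 * connCoeff ε c 0 * ((n q 0 * n p 1) ^ 2 - (n q 1 * n p 0) ^ 2) = 0 := by
        linear_combination n q 0 ^ 2 * hqp - n p 0 ^ 2 * hq
      have := (mul_eq_zero.1 this).resolve_left (mul_ne_zero (hs 1) m0)
      linarith
    rcases sq_eq_sq_iff_eq_or_eq_neg.1 hsq with h' | h'
    · exact h'
    · rw [h'] at hq'; nlinarith [sq_nonneg (n q 1 * n p 0)]
  have hTp : ∀ᶠ q in 𝓝 p, T q = T p := by
    filter_upwards [hprop, hn, h2, hne] with q hq hnq hq2 hneq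
    have hnp := hn.self_of_nhds
    have hp2 := h2.self_of_nhds
    have hnep := hne.self_of_nhds
    ext z
    rw [hnq.2, hnp.2, hq2, hp2]
    constructor
    · intro hz
      by_cases q0 : n q 0 = 0
      · have q1 := hneq q0
        have p0 : n p 0 = 0 := by simpa [q0, q1] using hq
        have z1 : E.repr z 1 = 0 := by simpa [q0, q1] using hz
        simp [p0, z1]
      · apply mul_left_cancel₀ q0
        linear_combination n p 0 * hz + E.repr z 1 * hq
    · intro hz
      by_cases p0 : n p 0 = 0
      · have p1 := hnep p0
        have q0 : n q 0 = 0 := by simpa [p0, p1] using hq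
        have z1 : E.repr z 1 = 0 := by simpa [p0, p1] using hz
        simp [q0, z1]
      · apply mul_left_cancel₀ p0
        linear_combination n q 0 * hz - E.repr z 1 * hq
  have hnp := hn.self_of_nhds
  have hp2 := h2.self_of_nhds
  have hqp := hquad.self_of_nhds
  -- The plane is now locally constant, so the left-invariant field with value U at p is tangent
  -- near p. The normal component of ∇_{E₂}U is μ₂ times the norm of n, which is nonzero.
  have hm2 : connCoeff ε c 2 = 0 := by
    obtain ⟨e0, e1, e2⟩ := repr_smul_add_smul_add_smul E (n p 1) (-n p 0) 0
    have hU : n p 1 • E 0 + (-n p 0) • E 1 + (0 : ℝ) • E 2 ∈ T p := by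
      rw [hnp.2, e0, e1, e2, hp2]; ring
    have := (hnp.2 _).1 (hT.leviCivita_mem p _ (hTp.mono fun q hq => hq ▸ hU)
      (E 2) hE2.self_of_nhds)
    rw [h.repr_leviCivita_zero, h.repr_leviCivita_one, h.repr_leviCivita_two, e0, e1, e2] at this
    simp only [Module.Basis.repr_self, Finsupp.single_apply, Fin.isValue, Fin.reduceEq, if_true,
      if_false, hp2] at this
    have hN := h.normal_norm_ne_zero hnp (hT.nondegenerate p)
    rw [hp2] at hN
    by_contra hm
    apply hN
    apply mul_left_cancel₀ hm
    linear_combination this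
  have hm0 : connCoeff ε c 0 ≠ 0 := fun m0 =>
    hflat 0 2 1 (by decide) (by decide) (by decide) m0 hm2
  have hm1 : connCoeff ε c 1 ≠ 0 := fun m1 =>
    hflat 1 2 0 (by decide) (by decide) (by decide) m1 hm2
  obtain ⟨hc0, hc1, hc2⟩ := h.mul_eq_connCoeff
  rw [hm2] at hc0 hc1
  rw [add_zero] at hc0
  rw [zero_add] at hc1
  have hsum : ε 2 * c 2 = ε 0 * c 0 + ε 1 * c 1 := by
    simp only [connCoeff] at hm2
    linarith
  have hcc : c 0 * n p 0 ^ 2 + c 1 * n p 1 ^ 2 = 0 := by rw [hc0, hc1]; exact hqp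
  have c0ne : c 0 ≠ 0 := by rw [hc0]; exact mul_ne_zero (hs 0) hm1
  have c1ne : c 1 ≠ 0 := by rw [hc1]; exact mul_ne_zero (hs 1) hm0
  have p0 : n p 0 ≠ 0 := fun p0 => hne.self_of_nhds p0 (by simpa [p0, c1ne] using hcc)
  have p1 : n p 1 ≠ 0 := fun p1 => p0 (by simpa [p1, c0ne] using hcc)
  have q0 : 0 < n p 0 ^ 2 := by positivity
  have q1 : 0 < n p 1 ^ 2 := by positivity
  -- The equation c₀n₀² + c₁n₁² = 0 makes the signs opposite: c₀ < 0 gives the identity relabeling,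
  -- c₀ > 0 the transposition. The sign of the square root relating n₀ and n₁ decides between s = 1
  -- and s = −1.
  rcases c0ne.lt_or_gt with hc0 | hc0
  · have hc1 : 0 < c 1 := by
      by_contra hcon
      nlinarith [mul_neg_of_neg_of_pos hc0 q0, mul_nonneg (neg_nonneg.2 (not_lt.1 hcon)) q1.le]
    have hr0 := Real.sq_sqrt (neg_nonneg.2 hc0.le)
    have hr1 := Real.sq_sqrt hc1.le
    have r0 : √(-c 0) ≠ 0 := (Real.sqrt_pos.2 (neg_pos.2 hc0)).ne'
    have r1 : √(c 1) ≠ 0 := (Real.sqrt_pos.2 hc1).ne'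
    have : (n p 0 * √(-c 0)) ^ 2 = (n p 1 * √(c 1)) ^ 2 := by
      rw [mul_pow, mul_pow, hr0, hr1]; linarith
    refine ⟨1, ⟨hsum, hc1, hc0⟩, ?_⟩
    simp only [diagPlane, Equiv.Perm.one_apply]
    rcases sq_eq_sq_iff_eq_or_eq_neg.1 this with h' | h'
    · refine ⟨-1, Or.inr rfl, hTp.mono fun q hq => hq.trans ?_⟩
      exact eq_span_of_isNormal hnp hp2 (Or.inl ⟨rfl, rfl⟩) r0 (mul_ne_zero (by norm_num) r1)
        (by linear_combination h')
    · refine ⟨1, Or.inl rfl, hTp.mono fun q hq => hq.trans ?_⟩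
      exact eq_span_of_isNormal hnp hp2 (Or.inl ⟨rfl, rfl⟩) r0 (mul_ne_zero (by norm_num) r1)
        (by linear_combination h')
  · have hc1 : c 1 < 0 := by
      by_contra hcon
      nlinarith [mul_pos hc0 q0, mul_nonneg (not_lt.1 hcon) q1.le]
    have hr1 := Real.sq_sqrt (neg_nonneg.2 hc1.le)
    have hr0 := Real.sq_sqrt hc0.le
    have r1 : √(-c 1) ≠ 0 := (Real.sqrt_pos.2 (neg_pos.2 hc1)).ne'
    have r0 : √(c 0) ≠ 0 := (Real.sqrt_pos.2 hc0).ne'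
    have : (n p 1 * √(-c 1)) ^ 2 = (n p 0 * √(c 0)) ^ 2 := by
      rw [mul_pow, mul_pow, hr0, hr1]; linarith
    refine ⟨Equiv.swap 0 1, ⟨?_, by simpa using hc0, by simpa using hc1⟩, ?_⟩
    · rw [show (Equiv.swap (0 : Fin 3) 1) 2 = 2 by decide, Equiv.swap_apply_left,
        Equiv.swap_apply_right]
      linarith
    unfold diagPlane
    rw [show (Equiv.swap (0 : Fin 3) 1) 2 = 2 by decide, Equiv.swap_apply_left,
      Equiv.swap_apply_right]
    rcases sq_eq_sq_iff_eq_or_eq_neg.1 this with h' | h'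
    · refine ⟨-1, Or.inr rfl, hTp.mono fun q hq => hq.trans ?_⟩
      exact eq_span_of_isNormal hnp hp2 (Or.inr ⟨rfl, rfl⟩) r1 (mul_ne_zero (by norm_num) r0)
        (by linear_combination h')
    · refine ⟨1, Or.inl rfl, hTp.mono fun q hq => hq.trans ?_⟩
      exact eq_span_of_isNormal hnp hp2 (Or.inr ⟨rfl, rfl⟩) r1 (mul_ne_zero (by norm_num) r0)
        (by linear_combination h')

/-- Local form of the classification, when some component of the normal vanishes. -/
theorem IsDiagonalBasis.eventually_eq_diagPlane_of_normal {S : Type*} [TopologicalSpace S]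
    {hB : B.Nondegenerate} {T : S → Submodule ℝ L}
    (h : IsDiagonalBasis B E ε c) (hK : ∀ κ, ¬ HasSectionalCurvature B hB κ)
    (hT : IsGeodesicPlaneField B hB T) {p : S} {n : S → Fin 3 → ℝ} (hc : ContinuousAt n p)
    (hn : ∀ᶠ q in 𝓝 p, IsNormal E (T q) (n q)) {j : Fin 3} (hj : ∀ᶠ q in 𝓝 p, n q j = 0) :
    ∃ σ, Condition ε c σ ∧ ∃ s : ℝ, (s = 1 ∨ s = -1) ∧ ∀ᶠ q in 𝓝 p, T q = diagPlane E c σ s := by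
  have hrot : Continuous fun m : Fin 3 → ℝ => m ∘ finRotate 3 :=
    continuous_pi fun i => continuous_apply _
  have e1 : finRotate 3 1 = 2 := by decide
  have e2 : finRotate 3 2 = 0 := by decide
  have e0 : finRotate 3 0 = 1 := by decide
  have hc' : ContinuousAt (fun q => n q ∘ finRotate 3) p := hrot.continuousAt.comp hc
  have hn' := hn.mono fun q hq => hq.rotate
  fin_cases j
  · obtain ⟨σ, hσ, s, hs, hTs⟩ :=
      h.rotate.eventually_eq_diagPlane_of_normal_two hK hT hc' hn' (by simpa [e2] using hj)
    exact ⟨finRotate 3 * σ, hσ, s, hs, by simpa only [diagPlane_rotate] using hTs⟩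
  · obtain ⟨σ, hσ, s, hs, hTs⟩ :=
      h.rotate.rotate.eventually_eq_diagPlane_of_normal_two hK hT
        (n := fun q => (n q ∘ finRotate 3) ∘ finRotate 3) (hrot.continuousAt.comp hc')
        (hn'.mono fun q hq => hq.rotate) (by simpa [e2, e0] using hj)
    exact ⟨finRotate 3 * (finRotate 3 * σ), hσ, s, hs,
      by simpa only [diagPlane_rotate] using hTs⟩
  · exact h.eventually_eq_diagPlane_of_normal_two hK hT hc hn hj

/-- Some component of the normal of a totally geodesic surface vanishes, locally. -/
theorem IsDiagonalBasis.exists_eventually_normal_eq_zero {S : Type*} [TopologicalSpace S]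
    {hB : B.Nondegenerate} {T : S → Submodule ℝ L}
    (h : IsDiagonalBasis B E ε c) (hK : ∀ κ, ¬ HasSectionalCurvature B hB κ)
    (hT : IsGeodesicPlaneField B hB T) {p : S} {n : S → Fin 3 → ℝ} (hc : ContinuousAt n p)
    (hn : ∀ᶠ q in 𝓝 p, IsNormal E (T q) (n q)) : ∃ j, ∀ᶠ q in 𝓝 p, n q j = 0 := by
  -- At each point this only says that one of two components vanishes; a component that is nonzero
  -- at p stays nonzero nearby, which makes the choice uniform near p.
  have hprod : ∀ᶠ q in 𝓝 p, ∀ i j, secCoeff ε c i ≠ secCoeff ε c j → n q i = 0 ∨ n q j = 0 := by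
    filter_upwards [hn] with q hq i j hij
    obtain ⟨h01, h12, h20⟩ :=
      h.normal_mul_normal hB hq (hT.nondegenerate q) (hT.curvature_mem q)
    rw [← sub_ne_zero] at hij
    rw [← mul_eq_zero]
    refine (mul_eq_zero.1 (?_ : n q i * n q j * (secCoeff ε c i - secCoeff ε c j) = 0)).resolve_right
      hij
    fin_cases i <;> fin_cases j <;> simp only [Fin.mk_one, Fin.zero_eta, Fin.reduceFinMk] <;>
      first
      | ring1
      | linear_combination h01
      | linear_combination h12
      | linear_combination h20
      | linear_combination -h01
      | linear_combination -h12
      | linear_combination -h20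
  have hev : ∀ i, n p i ≠ 0 → ∀ᶠ q in 𝓝 p, n q i ≠ 0 := fun i hi =>
    ((continuous_apply i).continuousAt.comp hc).eventually_ne hi
  -- Since the three K's are not all equal, some Kᵢ can be chosen different from both others. If nᵢ
  -- is nonzero at p, then nⱼ vanishes nearby; if not, another component is nonzero at p and nᵢ
  -- vanishes nearby.
  have key : ∀ i j k : Fin 3, (∀ l, l = i ∨ l = j ∨ l = k) →
      secCoeff ε c i ≠ secCoeff ε c j → secCoeff ε c i ≠ secCoeff ε c k →
      ∃ j, ∀ᶠ q in 𝓝 p, n q j = 0 := by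
    intro i j k hall hij hik
    by_cases hi : n p i = 0
    · refine ⟨i, ?_⟩
      by_cases hj : n p j = 0
      · have hk : n p k ≠ 0 := fun hk => hn.self_of_nhds.1 (by
          ext l; rcases hall l with rfl | rfl | rfl <;> assumption)
        filter_upwards [hprod, hev k hk] with q hq hqk
        exact (hq i k hik).resolve_right hqk
      · filter_upwards [hprod, hev j hj] with q hq hqj
        exact (hq i j hij).resolve_right hqj
    · refine ⟨j, ?_⟩
      filter_upwards [hprod, hev i hi] with q hq hqi
      exact (hq i j hij).resolve_left hqi
  by_cases h01 : secCoeff ε c 0 = secCoeff ε c 1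
  · have h12 : secCoeff ε c 1 ≠ secCoeff ε c 2 := fun h12 =>
      hK _ (h.hasSectionalCurvature hB h01 h12)
    exact key 2 0 1 (by decide) (by rw [h01]; exact h12.symm) h12.symm
  · by_cases h12 : secCoeff ε c 1 = secCoeff ε c 2
    · exact key 0 1 2 (by decide) h01 (by rwa [← h12])
    · exact key 1 0 2 (by decide) (Ne.symm h01) h12

/-- The tangent planes of a connected nondegenerate totally geodesic surface are all the same
left-invariant plane, of the form `diagPlane`. -/
theorem IsDiagonalBasis.exists_eq_diagPlane {S : Type*} [TopologicalSpace S] [ConnectedSpace S]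
    {hB : B.Nondegenerate} {T : S → Submodule ℝ L}
    (h : IsDiagonalBasis B E ε c) (hK : ∀ κ, ¬ HasSectionalCurvature B hB κ)
    (hT : IsGeodesicPlaneField B hB T)
    (hn : ∀ p, ∃ n : S → Fin 3 → ℝ, ContinuousAt n p ∧ ∀ᶠ q in 𝓝 p, IsNormal E (T q) (n q)) :
    ∃ σ, Condition ε c σ ∧ ∃ s : ℝ, (s = 1 ∨ s = -1) ∧ ∀ p, T p = diagPlane E c σ s := by
  have hloc : ∀ p, ∃ σ, Condition ε c σ ∧ ∃ s : ℝ, (s = 1 ∨ s = -1) ∧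
      ∀ᶠ q in 𝓝 p, T q = diagPlane E c σ s := by
    intro p
    obtain ⟨n, hc, hnn⟩ := hn p
    obtain ⟨j, hj⟩ := h.exists_eventually_normal_eq_zero hK hT hc hnn
    exact h.eventually_eq_diagPlane_of_normal hK hT hc hnn hj
  have hconst : IsLocallyConstant T := by
    rw [IsLocallyConstant.iff_eventually_eq]
    intro p
    obtain ⟨σ, -, s, -, hs⟩ := hloc p
    exact hs.mono fun q hq => hq.trans hs.self_of_nhds.symm
  obtain ⟨p₀⟩ := (inferInstance : Nonempty S)
  obtain ⟨σ, hσ, s, hs, hev⟩ := hloc p₀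
  exact ⟨σ, hσ, s, hs, fun p =>
    (hconst.apply_eq_of_preconnectedSpace p p₀).trans hev.self_of_nhds⟩

end DiagonalAlgebra
-- Left-invariant vector fields in a chart.
section InvariantFields

variable {G : Type*} [TopologicalSpace G] [ChartedSpace (EuclideanSpace ℝ (Fin 3)) G] [Group G]

/-- The left-invariant vector field of `z`, read in the chart at `g₀`. -/
def chartField (g₀ : G) (z : LieAlg G) (y : EuclideanSpace ℝ (Fin 3)) : EuclideanSpace ℝ (Fin 3) :=
  VectorField.mpullbackWithin 𝓘(ℝ, EuclideanSpace ℝ (Fin 3)) (𝓡 3) (extChartAt (𝓡 3) g₀).symm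
    (mulInvariantVectorField z) (range (𝓡 3)) y

theorem chartField_add (g₀ : G) (z w : LieAlg G) (y : EuclideanSpace ℝ (Fin 3)) :
    chartField g₀ (z + w) y = chartField g₀ z y + chartField g₀ w y := by
  simp only [chartField]
  rw [mulInvariantVectorField_add]
  exact VectorField.mpullbackWithin_add_apply

theorem chartField_smul (g₀ : G) (r : ℝ) (z : LieAlg G) (y : EuclideanSpace ℝ (Fin 3)) :
    chartField g₀ (r • z) y = r • chartField g₀ z y := by
  simp only [chartField]
  rw [mulInvariantVectorField_smul]
  exact VectorField.mpullbackWithin_const_smul_apply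

/-- The frame of left-invariant vector fields, read in the chart at `g₀`. -/
def chartFrame (g₀ : G) (y : EuclideanSpace ℝ (Fin 3)) :
    EuclideanSpace ℝ (Fin 3) →L[ℝ] EuclideanSpace ℝ (Fin 3) :=
  ∑ i, (EuclideanSpace.proj i : EuclideanSpace ℝ (Fin 3) →L[ℝ] ℝ).smulRight
    (chartField g₀ (EuclideanSpace.basisFun (Fin 3) ℝ i : EuclideanSpace ℝ (Fin 3)) y)

theorem chartFrame_apply (g₀ : G) (y z : EuclideanSpace ℝ (Fin 3)) :
    chartFrame g₀ y z = chartField g₀ z y := by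
  let l : EuclideanSpace ℝ (Fin 3) →ₗ[ℝ] EuclideanSpace ℝ (Fin 3) :=
    { toFun := fun z => chartField g₀ z y
      map_add' := fun z w => chartField_add g₀ z w y
      map_smul' := fun r z => chartField_smul g₀ r z y }
  have hl : chartFrame g₀ y z = ∑ i, z i • l (EuclideanSpace.basisFun (Fin 3) ℝ i) := by
    simp only [chartFrame, _root_.sum_apply]
    rfl
  have hz : z = ∑ i, z i • EuclideanSpace.basisFun (Fin 3) ℝ i :=
    ((EuclideanSpace.basisFun (Fin 3) ℝ).sum_repr z).symm
  change chartFrame g₀ y z = l z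
  rw [hl]
  conv_rhs => rw [hz, map_sum]
  simp only [map_smul]

variable [LieGroup (𝓡 3) ∞ G]

/-- The field is the tangent map of multiplication applied to the pair (0 at g, v at 1), which
depends smoothly on g. -/
theorem contMDiff_mulInvariantVectorField_infty (v : LieAlg G) :
    ContMDiff (𝓡 3) (𝓡 3).tangent ∞
      (fun g : G => (⟨g, mulInvariantVectorField v g⟩ : TangentBundle (𝓡 3) G)) := by
  let fg : G → TangentBundle (𝓡 3) G := fun g ↦ Bundle.TotalSpace.mk' _ g 0
  have sfg : ContMDiff (𝓡 3) (𝓡 3).tangent ∞ fg := Bundle.contMDiff_zeroSection _ _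
  let fv : G → TangentBundle (𝓡 3) G := fun _ ↦ Bundle.TotalSpace.mk' _ 1 v
  have sfv : ContMDiff (𝓡 3) (𝓡 3).tangent ∞ fv := contMDiff_const
  have S₁ : ContMDiff (𝓡 3) ((𝓡 3).tangent.prod (𝓡 3).tangent) ∞ (fun g => (fg g, fv g)) :=
    sfg.prodMk sfv
  have S₂ := contMDiff_equivTangentBundleProd_symm (I := 𝓡 3) (I' := 𝓡 3) (M := G) (M' := G)
    (n := ∞)
  have S₃ := ContMDiff.contMDiff_tangentMap (contMDiff_mul (𝓡 3) ∞ (G := G)) (m := ∞) le_rfl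
  convert! (S₃.comp S₂).comp S₁ with g
  · simp [fg, fv]
  · simp only [Function.comp_apply, tangentMap, fg, fv]
    rw [mfderiv_prod_eq_add_apply ((contMDiff_mul (𝓡 3) ∞).mdifferentiableAt (by simp))]
    change _ = mfderiv (𝓡 3) (𝓡 3) (fun z => z * (1 : G)) g 0
      + mfderiv (𝓡 3) (𝓡 3) (fun z => g * z) 1 v
    rw [map_zero, zero_add]
    rfl

instance instIsManifoldOneOfLieGroup : IsManifold (𝓡 3) 1 G :=
  IsManifold.of_le (n := ∞) (by simp)

theorem contDiffAt_chartField (g₀ : G) (z : LieAlg G) :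
    ContDiffAt ℝ ∞ (chartField g₀ z) (extChartAt (𝓡 3) g₀ g₀) := by
  have h := VectorField.contMDiffWithinAt_mpullbackWithin_extChartAt_symm (n := ∞) (m := ∞)
    (contMDiff_mulInvariantVectorField_infty z g₀).contMDiffWithinAt
    (s := univ) uniqueMDiffOn_univ (mem_univ _) (by simp)
  rw [contMDiffWithinAt_vectorSpace_iff_contDiffWithinAt] at h
  refine h.contDiffAt ?_
  simpa using extChartAt_target_mem_nhds (I := 𝓡 3) g₀

theorem contDiffAt_chartFrame (g₀ : G) :
    ContDiffAt ℝ ∞ (chartFrame g₀) (extChartAt (𝓡 3) g₀ g₀) := by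
  refine ContDiffAt.sum fun i _ => ?_
  exact (ContinuousLinearMap.smulRightL ℝ (EuclideanSpace ℝ (Fin 3)) (EuclideanSpace ℝ (Fin 3))
    (EuclideanSpace.proj i)).contDiff.contDiffAt.comp _ (contDiffAt_chartField g₀ _)

theorem mfderiv_extChartAt_mulInvariantVectorField {g₀ g : G}
    (hg : g ∈ (extChartAt (𝓡 3) g₀).source) (z : LieAlg G) :
    mfderiv (𝓡 3) 𝓘(ℝ, EuclideanSpace ℝ (Fin 3)) (extChartAt (𝓡 3) g₀) g
      (mulInvariantVectorField z g) = chartField g₀ z (extChartAt (𝓡 3) g₀ g) := by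
  have hinv := isInvertible_mfderivWithin_extChartAt_symm ((extChartAt (𝓡 3) g₀).map_source hg)
  have hg' := (extChartAt (𝓡 3) g₀).left_inv hg
  have h := mfderivWithin_extChartAt_symm_comp_mfderiv_extChartAt' (I := 𝓡 3) hg
  symm
  unfold chartField
  rw [VectorField.mpullbackWithin_apply, hinv.inverse_apply_eq]
  rw [hg']
  exact (congrArg (fun l => l (mulInvariantVectorField z g)) h).symm

theorem lieBracket_chartField (g₀ : G) (z w : LieAlg G) :
    VectorField.lieBracket ℝ (chartField g₀ z) (chartField g₀ w) (extChartAt (𝓡 3) g₀ g₀) =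
      chartField g₀ ⁅z, w⁆ (extChartAt (𝓡 3) g₀ g₀) := by
  have h := congrFun (mulInvariantVector_mlieBracket (I := 𝓡 3) (G := G) z w) g₀
  rw [← GroupLieAlgebra.bracket_def] at h
  have hmem := mem_extChartAt_source (I := 𝓡 3) g₀
  -- The manifold bracket is by definition the pullback of the bracket b of the fields read in the
  -- chart. The model has no boundary, so b is an ordinary bracket on the whole space.
  obtain ⟨b, hb⟩ : ∃ b : EuclideanSpace ℝ (Fin 3),
      b = VectorField.lieBracketWithin ℝ (chartField g₀ z) (chartField g₀ w)
        ((extChartAt (𝓡 3) g₀).symm ⁻¹' univ ∩ range (𝓡 3)) (extChartAt (𝓡 3) g₀ g₀) := ⟨_, rfl⟩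
  have h1 : VectorField.mlieBracket (𝓡 3) (mulInvariantVectorField z) (mulInvariantVectorField w) g₀
      = (mfderiv (𝓡 3) 𝓘(ℝ, EuclideanSpace ℝ (Fin 3)) (extChartAt (𝓡 3) g₀) g₀).inverse b := by
    rw [hb]; rfl
  rw [preimage_univ, univ_inter, ModelWithCorners.range_eq_univ,
    VectorField.lieBracketWithin_univ] at hb
  rw [← hb]
  refine Eq.trans ?_ (mfderiv_extChartAt_mulInvariantVectorField hmem ⁅z, w⁆)
  rw [h]
  exact (((isInvertible_mfderiv_extChartAt hmem).inverse_apply_eq).1 h1.symm)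

theorem mulInvariantVectorField_leftTriv (g : G) (v : TangentSpace (𝓡 3) g) :
    mulInvariantVectorField (leftTriv g v) g = v := by
  have h1 : MDifferentiableAt (𝓡 3) (𝓡 3) (fun h : G => g⁻¹ * h) g :=
    (contMDiff_mul_left (I := 𝓡 3) (n := ∞)).mdifferentiableAt (by simp)
  have h2 : MDifferentiableAt (𝓡 3) (𝓡 3) (fun h : G => g * h) (g⁻¹ * g) :=
    (contMDiff_mul_left (I := 𝓡 3) (n := ∞)).mdifferentiableAt (by simp)
  have h3 := mfderiv_comp g h2 h1
  have h4 : (fun h : G => g * h) ∘ (fun h : G => g⁻¹ * h) = id := by ext; simp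
  rw [h4, mfderiv_id] at h3
  have h5 := congrArg (fun l => l v) h3
  have h6 : v = mfderiv (𝓡 3) (𝓡 3) (fun h : G => g * h) (g⁻¹ * g) (leftTriv g v) := h5
  conv_rhs => rw [h6]
  rw [inv_mul_cancel]
  rfl

theorem leftTriv_mulInvariantVectorField (g : G) (z : LieAlg G) :
    leftTriv g (mulInvariantVectorField z g) = z := by
  have h1 : MDifferentiableAt (𝓡 3) (𝓡 3) (fun h : G => g * h) 1 :=
    (contMDiff_mul_left (I := 𝓡 3) (n := ∞)).mdifferentiableAt (by simp)
  have h2 : MDifferentiableAt (𝓡 3) (𝓡 3) (fun h : G => g⁻¹ * h) (g * 1) :=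
    (contMDiff_mul_left (I := 𝓡 3) (n := ∞)).mdifferentiableAt (by simp)
  have h3 := mfderiv_comp 1 h2 h1
  have h4 : (fun h : G => g⁻¹ * h) ∘ (fun h : G => g * h) = id := by ext; simp
  rw [h4, mfderiv_id] at h3
  have h5 := congrArg (fun l => l z) h3
  have h6 : z = mfderiv (𝓡 3) (𝓡 3) (fun h : G => g⁻¹ * h) (g * 1)
    (mulInvariantVectorField z g) := h5
  conv_rhs => rw [h6]
  rw [mul_one]
  rfl

theorem chartFrame_injective {g₀ g : G} (hg : g ∈ (extChartAt (𝓡 3) g₀).source) :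
    Function.Injective (chartFrame g₀ (extChartAt (𝓡 3) g₀ g)) := by
  intro z w hzw
  rw [chartFrame_apply, chartFrame_apply] at hzw
  have h1 := mfderiv_extChartAt_mulInvariantVectorField hg (z : LieAlg G)
  have h2 := mfderiv_extChartAt_mulInvariantVectorField hg (w : LieAlg G)
  have h3 := (isInvertible_mfderiv_extChartAt hg).injective (h1.trans (hzw.trans h2.symm))
  have h4 := congrArg (leftTriv g) h3
  exact (leftTriv_mulInvariantVectorField g _).symm.trans
    (h4.trans (leftTriv_mulInvariantVectorField g _))

end InvariantFields

/-! ### The pulled-back Maurer–Cartan form and its structure equation. -/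

section MaurerCartan

theorem contDiffAt_extChartAt_comp {M : Type*} [TopologicalSpace M]
    [ChartedSpace (EuclideanSpace ℝ (Fin 3)) M] [IsManifold (𝓡 3) 1 M]
    {V : Type*} [NormedAddCommGroup V] [NormedSpace ℝ V] {φ : V → M} {x : V} {n : ℕ∞ω}
    (hφ : ContMDiffAt 𝓘(ℝ, V) (𝓡 3) n φ x) :
    ContDiffAt ℝ n (fun y => extChartAt (𝓡 3) (φ x) (φ y)) x := by
  rw [← contMDiffAt_iff_contDiffAt]
  exact (contMDiffAt_iff_target.1 hφ).2

variable {G : Type*} [TopologicalSpace G] [ChartedSpace (EuclideanSpace ℝ (Fin 3)) G] [Group G]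
  {V : Type*} [NormedAddCommGroup V] [NormedSpace ℝ V]

/-- The pullback by `φ` of the left Maurer–Cartan form. -/
def mcForm (φ : V → G) (x : V) : V →L[ℝ] EuclideanSpace ℝ (Fin 3) :=
  (leftTriv (φ x)).comp (mfderiv 𝓘(ℝ, V) (𝓡 3) φ x)

/-- The Lie bracket of the Lie algebra, on the model space. -/
def modelBracket (G : Type*) [TopologicalSpace G] [ChartedSpace (EuclideanSpace ℝ (Fin 3)) G]
    [Group G] (z w : EuclideanSpace ℝ (Fin 3)) : EuclideanSpace ℝ (Fin 3) :=
  Bracket.bracket (L := LieAlg G) (M := LieAlg G) z w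

variable [LieGroup (𝓡 3) ∞ G]

theorem mulInvariantVectorField_mcForm (φ : V → G) (x u : V) :
    mulInvariantVectorField (mcForm φ x u : LieAlg G) (φ x) = mfderiv 𝓘(ℝ, V) (𝓡 3) φ x u :=
  mulInvariantVectorField_leftTriv (φ x) _

theorem chartFrame_mcForm {φ : V → G} {x : V} (hφ : MDifferentiableAt 𝓘(ℝ, V) (𝓡 3) φ x) {g₀ : G}
    (hx : φ x ∈ (extChartAt (𝓡 3) g₀).source) (u : V) :
    chartFrame g₀ (extChartAt (𝓡 3) g₀ (φ x)) (mcForm φ x u) =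
      fderiv ℝ (fun y => extChartAt (𝓡 3) g₀ (φ y)) x u := by
  rw [chartFrame_apply]
  refine (mfderiv_extChartAt_mulInvariantVectorField hx (mcForm φ x u : LieAlg G)).symm.trans ?_
  rw [mulInvariantVectorField_mcForm]
  have h1 : MDifferentiableAt (𝓡 3) 𝓘(ℝ, EuclideanSpace ℝ (Fin 3)) (extChartAt (𝓡 3) g₀) (φ x) :=
    mdifferentiableAt_extChartAt (by simpa using hx)
  rw [← mfderiv_eq_fderiv]
  have := mfderiv_comp x h1 hφ
  exact (congrArg (fun l => l u) this).symm

theorem eventually_chartFrame_mcForm {φ : V → G} {x : V}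
    (hφ : ContMDiffAt 𝓘(ℝ, V) (𝓡 3) ∞ φ x) :
    ∀ᶠ y in 𝓝 x, (chartFrame (φ x) (extChartAt (𝓡 3) (φ x) (φ y))).comp (mcForm φ y) =
      fderiv ℝ (fun y => extChartAt (𝓡 3) (φ x) (φ y)) y := by
  have h1 : ∀ᶠ y in 𝓝 x, ContMDiffAt 𝓘(ℝ, V) (𝓡 3) 1 φ y :=
    (contMDiffAt_iff_contMDiffAt_nhds (by simp)).1 (hφ.of_le (by simp))
  have h2 : ∀ᶠ y in 𝓝 x, φ y ∈ (extChartAt (𝓡 3) (φ x)).source :=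
    hφ.continuousAt.eventually (extChartAt_source_mem_nhds (I := 𝓡 3) (φ x))
  filter_upwards [h1, h2] with y hy1 hy2
  ext1 u
  exact chartFrame_mcForm (hy1.mdifferentiableAt (by simp)) hy2 u

/-- Near x the form is A(ψ)⁻¹ ∘ Dψ, where ψ is φ read in a chart and A is the frame `chartFrame`;
inversion of linear maps is smooth. -/
theorem contDiffAt_mcForm {φ : V → G} {x : V} (hφ : ContMDiffAt 𝓘(ℝ, V) (𝓡 3) ∞ φ x) :
    ContDiffAt ℝ ∞ (mcForm φ) x := by
  have hψ := contDiffAt_extChartAt_comp hφ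
  have hA : ContDiffAt ℝ ∞ (fun y => chartFrame (φ x) (extChartAt (𝓡 3) (φ x) (φ y))) x :=
    ContDiffAt.comp (g := chartFrame (φ x)) x (contDiffAt_chartFrame (φ x)) hψ
  have hinj := chartFrame_injective (mem_extChartAt_source (I := 𝓡 3) (φ x))
  let e : EuclideanSpace ℝ (Fin 3) ≃L[ℝ] EuclideanSpace ℝ (Fin 3) :=
    (LinearEquiv.ofInjectiveEndo
      (chartFrame (φ x) (extChartAt (𝓡 3) (φ x) (φ x))).toLinearMap hinj).toContinuousLinearEquiv
  have he : (e : EuclideanSpace ℝ (Fin 3) →L[ℝ] EuclideanSpace ℝ (Fin 3)) =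
      chartFrame (φ x) (extChartAt (𝓡 3) (φ x) (φ x)) := by
    ext1 z; rfl
  have hinv : ContDiffAt ℝ ∞ (fun y =>
      (chartFrame (φ x) (extChartAt (𝓡 3) (φ x) (φ y))).inverse) x := by
    have := contDiffAt_map_inverse (n := ∞) e
    rw [he] at this
    exact this.comp x hA
  have hd : ContDiffAt ℝ ∞ (fderiv ℝ (fun y => extChartAt (𝓡 3) (φ x) (φ y))) x :=
    hψ.fderiv_right (by simp)
  refine (hinv.clm_comp hd).congr_of_eventuallyEq ?_
  have h2 : ∀ᶠ y in 𝓝 x, φ y ∈ (extChartAt (𝓡 3) (φ x)).source :=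
    hφ.continuousAt.eventually (extChartAt_source_mem_nhds (I := 𝓡 3) (φ x))
  filter_upwards [eventually_chartFrame_mcForm hφ, h2] with y hy hy2
  rw [← hy]
  have hinj' := chartFrame_injective hy2
  have hI : (chartFrame (φ x) (extChartAt (𝓡 3) (φ x) (φ y))).IsInvertible :=
    ⟨(LinearEquiv.ofInjectiveEndo
      (chartFrame (φ x) (extChartAt (𝓡 3) (φ x) (φ y))).toLinearMap hinj').toContinuousLinearEquiv,
      by ext1 z; rfl⟩
  rw [← ContinuousLinearMap.comp_assoc, hI.inverse_comp_self, ContinuousLinearMap.id_comp]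

/-- The Maurer–Cartan equation. -/
theorem fderiv_mcForm_sub {φ : V → G} {x : V} (hφ : ContMDiffAt 𝓘(ℝ, V) (𝓡 3) ∞ φ x) (u v : V) :
    fderiv ℝ (mcForm φ) x u v - fderiv ℝ (mcForm φ) x v u =
      -modelBracket G (mcForm φ x u) (mcForm φ x v) := by
  set ψ : V → EuclideanSpace ℝ (Fin 3) := fun y => extChartAt (𝓡 3) (φ x) (φ y) with hψdef
  have hψ : ContDiffAt ℝ ∞ ψ x := contDiffAt_extChartAt_comp hφ
  have hA := contDiffAt_chartFrame (φ x)
  have hψ1 : DifferentiableAt ℝ ψ x := hψ.differentiableAt (by simp)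
  have hA1 : DifferentiableAt ℝ (chartFrame (φ x)) (ψ x) := hA.differentiableAt (by simp)
  have hΘ1 : DifferentiableAt ℝ (mcForm φ) x := (contDiffAt_mcForm hφ).differentiableAt (by simp)
  have hev := eventually_chartFrame_mcForm hφ
  have hsymm : IsSymmSndFDerivAt ℝ ψ x := hψ.isSymmSndFDerivAt (by
    rw [minSmoothness_of_isRCLikeNormedField]; exact WithTop.coe_le_coe.2 (le_top : (2 : ℕ∞) ≤ ⊤))
  have hcomp : fderiv ℝ (fun y => chartFrame (φ x) (ψ y)) x =
      (fderiv ℝ (chartFrame (φ x)) (ψ x)).comp (fderiv ℝ ψ x) := fderiv_comp x hA1 hψ1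
  -- The derivative of Dψ = A(ψ) ∘ Θ. The left side is symmetric in u and v; antisymmetrizing the
  -- right side leaves dΘ and the bracket term `hbr`.
  have h2 : ∀ u v, fderiv ℝ (fderiv ℝ ψ) x u v =
      fderiv ℝ (chartFrame (φ x)) (ψ x) (fderiv ℝ ψ x u) (mcForm φ x v) +
        chartFrame (φ x) (ψ x) (fderiv ℝ (mcForm φ) x u v) := by
    intro u v
    have e : fderiv ℝ ψ =ᶠ[𝓝 x] fun y => (chartFrame (φ x) (ψ y)).comp (mcForm φ y) :=
      hev.mono fun y hy => hy.symm
    rw [e.fderiv_eq, fderiv_clm_comp (c := fun y => chartFrame (φ x) (ψ y)) (hA1.comp x hψ1) hΘ1,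
      hcomp]
    simp [add_comm]
  have hbr : ∀ z w : EuclideanSpace ℝ (Fin 3), chartFrame (φ x) (ψ x) (modelBracket G z w) =
      fderiv ℝ (chartFrame (φ x)) (ψ x) (chartFrame (φ x) (ψ x) z) w -
      fderiv ℝ (chartFrame (φ x)) (ψ x) (chartFrame (φ x) (ψ x) w) z := by
    intro z w
    have hd : ∀ z v : EuclideanSpace ℝ (Fin 3), fderiv ℝ (chartField (φ x) z) (ψ x) v =
        fderiv ℝ (chartFrame (φ x)) (ψ x) v z := by
      intro z v
      have : chartField (φ x) z = fun y => chartFrame (φ x) y z := by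
        ext1 y; exact (chartFrame_apply _ _ _).symm
      rw [this, fderiv_clm_apply hA1 (differentiableAt_const z)]
      simp
    rw [chartFrame_apply]
    refine (lieBracket_chartField (φ x) z w).symm.trans ?_
    rw [VectorField.lieBracket_eq]
    change fderiv ℝ (chartField (φ x) w) (ψ x) (chartField (φ x) z (ψ x)) -
      fderiv ℝ (chartField (φ x) z) (ψ x) (chartField (φ x) w (ψ x)) = _
    rw [hd, hd, chartFrame_apply, chartFrame_apply]
  have hx := hev.self_of_nhds
  have hx' : ∀ u, fderiv ℝ ψ x u = chartFrame (φ x) (ψ x) (mcForm φ x u) := fun u =>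
    (congrArg (fun l => l u) hx).symm
  apply chartFrame_injective (mem_extChartAt_source (I := 𝓡 3) (φ x))
  change chartFrame (φ x) (ψ x) _ = chartFrame (φ x) (ψ x) _
  rw [map_neg, map_sub, hbr, ← hx', ← hx']
  have h3 := hsymm u v
  rw [h2, h2] at h3
  rw [neg_sub, sub_eq_sub_iff_add_eq_add, add_comm, h3, add_comm]

end MaurerCartan

/-! ### Covariant derivatives along a map and the Ricci identity. -/

section Bilinear

variable {L : Type*} [LieRing L] [LieAlgebra ℝ L] [FiniteDimensional ℝ L]

/-- The Levi-Civita connection as a bilinear map. -/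
def leviCivitaBilin (B : LinearMap.BilinForm ℝ L) (hB : B.Nondegenerate) : L →ₗ[ℝ] L →ₗ[ℝ] L :=
  LinearMap.mk₂ ℝ (leviCivita B hB)
    (fun X X' Y => by
      apply (B.toDual hB).injective
      ext Z
      simp only [LinearMap.BilinForm.toDual_def, map_add, LinearMap.add_apply, apply_leviCivita,
        add_lie, lie_add]
      ring)
    (fun r X Y => by
      apply (B.toDual hB).injective
      ext Z
      simp only [LinearMap.BilinForm.toDual_def, map_smul, LinearMap.smul_apply, apply_leviCivita,
        smul_lie, lie_smul, smul_eq_mul]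
      ring)
    (fun X Y Y' => by
      apply (B.toDual hB).injective
      ext Z
      simp only [LinearMap.BilinForm.toDual_def, map_add, LinearMap.add_apply, apply_leviCivita,
        add_lie, lie_add]
      ring)
    (fun r X Y => by
      apply (B.toDual hB).injective
      ext Z
      simp only [LinearMap.BilinForm.toDual_def, map_smul, LinearMap.smul_apply, apply_leviCivita,
        smul_lie, lie_smul, smul_eq_mul]
      ring)

theorem leviCivitaBilin_apply (B : LinearMap.BilinForm ℝ L) (hB : B.Nondegenerate) (X Y : L) :
    leviCivitaBilin B hB X Y = leviCivita B hB X Y := rfl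

theorem sum_repr_smul_leviCivita (B : LinearMap.BilinForm ℝ L) (hB : B.Nondegenerate)
    (E : Module.Basis (Fin 3) ℝ L) (X Y : L) :
    ∑ i, E.repr Y i • leviCivita B hB X (E i) = leviCivita B hB X Y := by
  simp only [← leviCivitaBilin_apply, ← map_smul]
  rw [← map_sum, E.sum_repr]

end Bilinear

section Commutator

variable {V W : Type*} [NormedAddCommGroup V] [NormedSpace ℝ V] [NormedAddCommGroup W]
  [NormedSpace ℝ W]

/-- The covariant derivative `∂_v F + ∇_{Θ(v)} F`. -/
def pullCov (Θ : V → V →L[ℝ] W) (Γ : W →L[ℝ] W →L[ℝ] W) (F : V → W) (v : V) (x : V) : W :=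
  fderiv ℝ F x v + Γ (Θ x v) (F x)

theorem contDiffAt_pullCov {Θ : V → V →L[ℝ] W} (Γ : W →L[ℝ] W →L[ℝ] W) {F : V → W} {x : V}
    (hΘ : ContDiffAt ℝ ∞ Θ x) (hF : ContDiffAt ℝ ∞ F x) (v : V) :
    ContDiffAt ℝ ∞ (pullCov Θ Γ F v) x := by
  have h1 : ContDiffAt ℝ ∞ (fderiv ℝ F) x := hF.fderiv_right (by simp)
  exact (h1.clm_apply contDiffAt_const).add
    ((Γ.contDiff.contDiffAt.comp x (hΘ.clm_apply contDiffAt_const)).clm_apply hF)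

/-- The Ricci identity for `pullCov`. -/
theorem pullCov_comm {Θ : V → V →L[ℝ] W} (Γ : W →L[ℝ] W →L[ℝ] W) {F : V → W} {x : V}
    (hΘ : ContDiffAt ℝ ∞ Θ x) (hF : ContDiffAt ℝ ∞ F x) {u v : V} {b : W}
    (hb : fderiv ℝ Θ x u v - fderiv ℝ Θ x v u = -b) :
    pullCov Θ Γ (pullCov Θ Γ F v) u x - pullCov Θ Γ (pullCov Θ Γ F u) v x =
      Γ (Θ x u) (Γ (Θ x v) (F x)) - Γ (Θ x v) (Γ (Θ x u) (F x)) - Γ b (F x) := by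
  have hF1 : DifferentiableAt ℝ F x := hF.differentiableAt (by simp)
  have hF2 : DifferentiableAt ℝ (fderiv ℝ F) x :=
    ContDiffAt.differentiableAt (n := ∞) (hF.fderiv_right (by simp)) (by simp)
  have hΘ1 : DifferentiableAt ℝ Θ x := hΘ.differentiableAt (by simp)
  have hsymm : IsSymmSndFDerivAt ℝ F x := hF.isSymmSndFDerivAt (by
    rw [minSmoothness_of_isRCLikeNormedField]; exact WithTop.coe_le_coe.2 (le_top : (2 : ℕ∞) ≤ ⊤))
  have hd : ∀ u v, fderiv ℝ (pullCov Θ Γ F v) x u = fderiv ℝ (fderiv ℝ F) x u v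
      + Γ (fderiv ℝ Θ x u v) (F x) + Γ (Θ x v) (fderiv ℝ F x u) := by
    intro u v
    have h1 := (hF2.hasFDerivAt.clm_apply (hasFDerivAt_const v x))
    have h2 := (hΘ1.hasFDerivAt.clm_apply (hasFDerivAt_const v x))
    have h3 := (Γ.hasFDerivAt.comp x h2).clm_apply hF1.hasFDerivAt
    have h4 : HasFDerivAt (pullCov Θ Γ F v) _ x := h1.add h3
    rw [h4.fderiv]
    simp
    abel
  have hb' := congrArg (fun z => Γ z (F x)) hb
  simp only [map_sub, map_neg, sub_apply, neg_apply] at hb'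
  have hs := hsymm u v
  have hp : ∀ (H : V → W) (a : V), pullCov Θ Γ H a x = fderiv ℝ H x a + Γ (Θ x a) (H x) :=
    fun _ _ => rfl
  rw [hp (pullCov Θ Γ F v) u, hp (pullCov Θ Γ F u) v, hd, hd, hp F, hp F, hs]
  simp only [map_add]
  linear_combination (norm := module) hb'

end Commutator

section Connection

variable {G : Type*} [TopologicalSpace G] [ChartedSpace (EuclideanSpace ℝ (Fin 3)) G] [Group G]
  [LieGroup (𝓡 3) ∞ G]

/-- The Levi-Civita connection on the model space. -/
def modelConn (m : LeftInvariantMetric G) :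
    EuclideanSpace ℝ (Fin 3) →L[ℝ] EuclideanSpace ℝ (Fin 3) →L[ℝ] EuclideanSpace ℝ (Fin 3) :=
  LinearMap.toContinuousBilinearMap
    (leviCivitaBilin m.form m.nondegenerate :
      EuclideanSpace ℝ (Fin 3) →ₗ[ℝ] EuclideanSpace ℝ (Fin 3) →ₗ[ℝ] EuclideanSpace ℝ (Fin 3))

/-- A coordinate of the Lie algebra, as a continuous linear form on the model space. -/
def modelCoord (E : Module.Basis (Fin 3) ℝ (LieAlg G)) (i : Fin 3) :
    EuclideanSpace ℝ (Fin 3) →L[ℝ] ℝ :=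
  LinearMap.toContinuousLinearMap (E.coord i : EuclideanSpace ℝ (Fin 3) →ₗ[ℝ] ℝ)

theorem leftTriv_injective (g : G) : Function.Injective (leftTriv g) := fun v w h => by
  rw [← mulInvariantVectorField_leftTriv g v, h, mulInvariantVectorField_leftTriv]

end Connection

/-! ### From totally geodesic surfaces to plane fields in the Lie algebra. -/

section Surfaces

/-- The map `φ` in the chart at `p`. -/
def inChart {G : Type*} {S : Surface} (φ : S.carrier → G) (p : S.carrier) (y : EuclideanSpace ℝ (Fin 2)) : G :=
  φ ((extChartAt (𝓡 2) p).symm y)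

instance instIsManifoldOneSurface (S : Surface) : IsManifold (𝓡 2) 1 S.carrier :=
  IsManifold.of_le (n := ∞) (by simp)

theorem contMDiffAt_inChart {G : Type*} [TopologicalSpace G]
    [ChartedSpace (EuclideanSpace ℝ (Fin 3)) G] {S : Surface} {φ : S.carrier → G}
    (hφ : ContMDiff (𝓡 2) (𝓡 3) ∞ φ) {p : S.carrier}
    {y : EuclideanSpace ℝ (Fin 2)} (hy : y ∈ (extChartAt (𝓡 2) p).target) :
    ContMDiffAt (𝓡 2) (𝓡 3) ∞ (inChart φ p) y := by
  have h1 := (contMDiffOn_extChartAt_symm (I := 𝓡 2) (n := ∞) p).contMDiffAt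
    ((isOpen_extChartAt_target (I := 𝓡 2) p).mem_nhds hy)
  exact (hφ _).comp y h1

variable {G : Type*} [TopologicalSpace G] [ChartedSpace (EuclideanSpace ℝ (Fin 3)) G] [Group G]
  {S : Surface}

/-- The chart at p is kept fixed while q varies in its domain, so that tangent planes can be
differentiated in one vector space. -/
theorem leftDiff_eq_mcForm {φ : S.carrier → G} (hφ : ContMDiff (𝓡 2) (𝓡 3) ∞ φ) {p q : S.carrier}
    (hq : q ∈ (extChartAt (𝓡 2) p).source) (w : TangentSpace (𝓡 2) q) :
    leftDiff φ q w = mcForm (inChart φ p) (extChartAt (𝓡 2) p q)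
      (mfderiv (𝓡 2) (𝓡 2) (extChartAt (𝓡 2) p) q w) := by
  have h1 : MDifferentiableAt (𝓡 2) (𝓡 3) (inChart φ p) (extChartAt (𝓡 2) p q) :=
    (contMDiffAt_inChart hφ ((extChartAt (𝓡 2) p).map_source hq)).mdifferentiableAt (by simp)
  have h2 : MDifferentiableAt (𝓡 2) (𝓡 2) (extChartAt (𝓡 2) p) q :=
    mdifferentiableAt_extChartAt (by simpa using hq)
  have h3 : φ =ᶠ[𝓝 q] inChart φ p ∘ extChartAt (𝓡 2) p := by
    filter_upwards [(isOpen_extChartAt_source (I := 𝓡 2) p).mem_nhds hq] with q' hq'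
    simp only [inChart, Function.comp_apply, (extChartAt (𝓡 2) p).left_inv hq']
  have h4 : mfderiv (𝓡 2) (𝓡 3) φ q w = mfderiv (𝓡 2) (𝓡 3) (inChart φ p) (extChartAt (𝓡 2) p q)
      (mfderiv (𝓡 2) (𝓡 2) (extChartAt (𝓡 2) p) q w) := by
    rw [h3.mfderiv_eq]
    exact mfderiv_comp_apply q h1 h2 w
  have h5 : φ q = inChart φ p (extChartAt (𝓡 2) p q) := h3.self_of_nhds
  change leftTriv (φ q) (mfderiv (𝓡 2) (𝓡 3) φ q w) =
    leftTriv (inChart φ p (extChartAt (𝓡 2) p q)) _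
  rw [h4, h5]
  rfl

theorem mem_tangentPlane_iff {φ : S.carrier → G} (hφ : ContMDiff (𝓡 2) (𝓡 3) ∞ φ)
    {p q : S.carrier} (hq : q ∈ (extChartAt (𝓡 2) p).source) (z : LieAlg G) :
    z ∈ tangentPlane φ q ↔ ∃ u, mcForm (inChart φ p) (extChartAt (𝓡 2) p q) u = z := by
  constructor
  · rintro ⟨w, rfl⟩
    exact ⟨_, (leftDiff_eq_mcForm hφ hq w).symm⟩
  · rintro ⟨u, rfl⟩
    obtain ⟨w, hw⟩ := (isInvertible_mfderiv_extChartAt (I := 𝓡 2) hq).surjective u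
    exact ⟨w, by rw [← hw]; exact leftDiff_eq_mcForm hφ hq w⟩

variable [LieGroup (𝓡 3) ∞ G]

theorem leftDiff_injective {φ : S.carrier → G} (hφ : IsImmersion φ) (p : S.carrier) :
    Function.Injective (leftDiff φ p) :=
  (leftTriv_injective (φ p)).comp (hφ.injective p)

theorem mcForm_inChart_injective {φ : S.carrier → G} (hφ : IsImmersion φ) {p q : S.carrier}
    (hq : q ∈ (extChartAt (𝓡 2) p).source) :
    Function.Injective (mcForm (inChart φ p) (extChartAt (𝓡 2) p q)) := by
  intro u v huv
  obtain ⟨u', rfl⟩ := (isInvertible_mfderiv_extChartAt (I := 𝓡 2) hq).surjective u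
  obtain ⟨v', rfl⟩ := (isInvertible_mfderiv_extChartAt (I := 𝓡 2) hq).surjective v
  rw [leftDiff_injective hφ q ((leftDiff_eq_mcForm hφ.contMDiff hq u').trans
    (huv.trans (leftDiff_eq_mcForm hφ.contMDiff hq v').symm))]

/-- The condition of being totally geodesic, in a chart. -/
theorem IsTotallyGeodesic.pullCov_mem {m : LeftInvariantMetric G}
    {E : Module.Basis (Fin 3) ℝ (LieAlg G)} {φ : S.carrier → G} (h : IsTotallyGeodesic m E φ)
    (hφ : ContMDiff (𝓡 2) (𝓡 3) ∞ φ) {p q : S.carrier}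
    (hq : q ∈ (extChartAt (𝓡 2) p).source)
    {F : EuclideanSpace ℝ (Fin 2) → EuclideanSpace ℝ (Fin 3)}
    (hF : ContDiffAt ℝ ∞ F (extChartAt (𝓡 2) p q))
    (hmem : ∀ᶠ y in 𝓝 (extChartAt (𝓡 2) p q), ∃ u, mcForm (inChart φ p) y u = F y)
    (v : EuclideanSpace ℝ (Fin 2)) :
    ∃ u, mcForm (inChart φ p) (extChartAt (𝓡 2) p q) u =
      pullCov (mcForm (inChart φ p)) (modelConn m) F v (extChartAt (𝓡 2) p q) := by
  obtain ⟨w, rfl⟩ := (isInvertible_mfderiv_extChartAt (I := 𝓡 2) hq).surjective v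
  have hχ : ContMDiffAt (𝓡 2) (𝓡 2) ∞ (extChartAt (𝓡 2) p) q :=
    contMDiffAt_extChartAt' (by simpa using hq)
  have hχ1 : MDifferentiableAt (𝓡 2) (𝓡 2) (extChartAt (𝓡 2) p) q :=
    hχ.mdifferentiableAt (by simp)
  have hlF : ∀ i, ContDiffAt ℝ ∞ (fun y => modelCoord E i (F y)) (extChartAt (𝓡 2) p q) :=
    fun i => (modelCoord E i).contDiff.contDiffAt.comp _ hF
  have key := h q (fun i q' => modelCoord E i (F (extChartAt (𝓡 2) p q')))
    (fun i => ContMDiffAt.comp (I' := 𝓡 2) (g := fun y => modelCoord E i (F y)) q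
      (hlF i).contMDiffAt hχ) ?_ w
  · rw [mem_tangentPlane_iff hφ hq] at key
    convert! key using 2
    rw [covDeriv, Finset.sum_add_distrib]
    have hd : ∀ i, mvfderiv (𝓡 2) (fun q' => modelCoord E i (F (extChartAt (𝓡 2) p q'))) q w =
        modelCoord E i (fderiv ℝ F (extChartAt (𝓡 2) p q)
          (mfderiv (𝓡 2) (𝓡 2) (extChartAt (𝓡 2) p) q w)) := by
      intro i
      have h1 : MDifferentiableAt (𝓡 2) 𝓘(ℝ, ℝ) (fun y => modelCoord E i (F y))
          (extChartAt (𝓡 2) p q) := (hlF i).contMDiffAt.mdifferentiableAt (by simp)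
      have h2 := mfderiv_comp_apply q h1 hχ1 w
      have h3 : fderiv ℝ (fun y => modelCoord E i (F y)) (extChartAt (𝓡 2) p q) =
          (modelCoord E i).comp (fderiv ℝ F (extChartAt (𝓡 2) p q)) :=
        ((modelCoord E i).hasFDerivAt.comp _
          (hF.differentiableAt (by simp)).hasFDerivAt).fderiv
      rw [mfderiv_eq_fderiv, h3] at h2
      exact h2
    simp only [hd]
    have e1 : ∑ i, modelCoord E i (fderiv ℝ F (extChartAt (𝓡 2) p q)
          (mfderiv (𝓡 2) (𝓡 2) (extChartAt (𝓡 2) p) q w)) • E i =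
        fderiv ℝ F (extChartAt (𝓡 2) p q) (mfderiv (𝓡 2) (𝓡 2) (extChartAt (𝓡 2) p) q w) :=
      E.sum_repr _
    have e2 : ∑ i, modelCoord E i (F (extChartAt (𝓡 2) p q)) •
        leviCivita m.form m.nondegenerate (leftDiff φ q w) (E i) =
        leviCivita m.form m.nondegenerate (leftDiff φ q w) (F (extChartAt (𝓡 2) p q)) :=
      sum_repr_smul_leviCivita _ _ E _ _
    rw [e1, e2, leftDiff_eq_mcForm hφ hq w]
    rfl
  · have hsrc := (isOpen_extChartAt_source (I := 𝓡 2) p).mem_nhds hq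
    filter_upwards [hχ.continuousAt.eventually hmem, hsrc] with q' hq' hs
    have e1 : ∑ i, modelCoord E i (F (extChartAt (𝓡 2) p q')) • E i =
      F (extChartAt (𝓡 2) p q') := E.sum_repr _
    rw [e1]
    exact (mem_tangentPlane_iff hφ hs _).2 hq'

/-- A left-invariant field has constant coefficients, so its covariant derivative is purely
algebraic. For the curvature, X, Y and Z are extended to the tangent fields Θ(u), Θ(v), Θ(w) with u,
v, w constant in the chart; second covariant derivatives stay tangent and their commutator is
R(X,Y)Z. -/
theorem IsTotallyGeodesic.isGeodesicPlaneField {m : LeftInvariantMetric G}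
    {E : Module.Basis (Fin 3) ℝ (LieAlg G)} {φ : S.carrier → G} (h : IsTotallyGeodesic m E φ)
    (hφ : IsNondegenerateImmersion m φ) :
    IsGeodesicPlaneField m.form m.nondegenerate (tangentPlane φ) where
  leviCivita_mem p z hz w hw := by
    obtain ⟨w, rfl⟩ := hw
    have key := h p (fun i _ => E.repr z i) (fun i => contMDiffAt_const)
      (hz.mono fun q hq => by rwa [E.sum_repr]) w
    rw [covDeriv, Finset.sum_add_distrib, sum_repr_smul_leviCivita] at key
    simpa [mvfderiv_const] using key
  curvature_mem p X hX Y hY Z hZ := by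
    have hp := mem_extChartAt_source (I := 𝓡 2) p
    rw [mem_tangentPlane_iff hφ.contMDiff hp] at hX hY hZ ⊢
    obtain ⟨u, rfl⟩ := hX
    obtain ⟨v, rfl⟩ := hY
    obtain ⟨w, rfl⟩ := hZ
    set Θ := mcForm (inChart φ p) with hΘdef
    have hsm : ∀ y ∈ (extChartAt (𝓡 2) p).target, ContDiffAt ℝ ∞ Θ y := fun y hy =>
      contDiffAt_mcForm (contMDiffAt_inChart hφ.contMDiff hy)
    have hF : ∀ y ∈ (extChartAt (𝓡 2) p).target, ContDiffAt ℝ ∞ (fun y => Θ y w) y := fun y hy =>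
      (hsm y hy).clm_apply contDiffAt_const
    have hp' := (extChartAt (𝓡 2) p).map_source hp
    have step : ∀ a b, ∃ u', Θ (extChartAt (𝓡 2) p p) u' =
        pullCov Θ (modelConn m) (pullCov Θ (modelConn m) (fun y => Θ y w) a) b
          (extChartAt (𝓡 2) p p) := by
      intro a b
      refine h.pullCov_mem hφ.contMDiff hp
        (contDiffAt_pullCov (modelConn m) (hsm _ hp') (hF _ hp') a) ?_ b
      -- A second derivative requires the first one to be tangent on a neighborhood, so total
      -- geodesy is applied at every point of the chart and not only at p.
      filter_upwards [(isOpen_extChartAt_target (I := 𝓡 2) p).mem_nhds hp'] with y hy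
      have hq := (extChartAt (𝓡 2) p).map_target hy
      have hyq := (extChartAt (𝓡 2) p).right_inv hy
      have := h.pullCov_mem hφ.contMDiff hq (F := fun y => Θ y w) (by rw [hyq]; exact hF y hy)
        (Eventually.of_forall fun y' => ⟨w, rfl⟩) a
      rwa [hyq] at this
    obtain ⟨a, ha⟩ := step v u
    obtain ⟨b, hb⟩ := step u v
    refine ⟨a - b, ?_⟩
    rw [map_sub, ha, hb]
    exact pullCov_comm (modelConn m) (hsm _ hp') (hF _ hp')
      (fderiv_mcForm_sub (contMDiffAt_inChart hφ.contMDiff hp') u v)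
  nondegenerate p v hv hw := by
    obtain ⟨v, rfl⟩ := hv
    have := hφ.nondegenerate p v fun w => hw _ ⟨w, rfl⟩
    rw [this]
    exact map_zero _

/-- The normal is the cross product of the images under Θ of the two coordinate directions; it is
continuous because Θ is. -/
theorem IsImmersion.exists_isNormal {φ : S.carrier → G} (hφ : IsImmersion φ)
    (E : Module.Basis (Fin 3) ℝ (LieAlg G)) (p : S.carrier) :
    ∃ n : S.carrier → Fin 3 → ℝ, ContinuousAt n p ∧
      ∀ᶠ q in 𝓝 p, IsNormal E (tangentPlane φ q) (n q) := by
  set Θ := mcForm (inChart φ p) with hΘdef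
  let e : Fin 2 → EuclideanSpace ℝ (Fin 2) := EuclideanSpace.basisFun (Fin 2) ℝ
  have hp := mem_extChartAt_source (I := 𝓡 2) p
  have hsum : ∀ u : EuclideanSpace ℝ (Fin 2), u = u 0 • e 0 + u 1 • e 1 := fun u => by
    have := (EuclideanSpace.basisFun (Fin 2) ℝ).sum_repr u
    rw [Fin.sum_univ_two] at this
    exact this.symm
  have hpair : ∀ a b z : LieAlg G, z ∈ Submodule.span ℝ {a, b} ↔ ∃ s t : ℝ, s • a + t • b = z :=
    fun a b z => Submodule.mem_span_pair
  have hspan : ∀ q ∈ (extChartAt (𝓡 2) p).source, tangentPlane φ q =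
      Submodule.span ℝ {(Θ (extChartAt (𝓡 2) p q) (e 0) : LieAlg G),
        (Θ (extChartAt (𝓡 2) p q) (e 1) : LieAlg G)} := by
    intro q hq
    ext z
    refine (mem_tangentPlane_iff hφ.contMDiff hq z).trans
      (Iff.trans ?_ (hpair _ _ z).symm)
    constructor
    · rintro ⟨u, rfl⟩
      refine ⟨u 0, u 1, ?_⟩
      conv_rhs => rw [hsum u, map_add, map_smul, map_smul]
      rfl
    · rintro ⟨s, t, rfl⟩
      refine ⟨s • e 0 + t • e 1, ?_⟩
      rw [map_add, map_smul, map_smul]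
      rfl
  have hind : ∀ q ∈ (extChartAt (𝓡 2) p).source, ∀ s t : ℝ,
      s • (Θ (extChartAt (𝓡 2) p q) (e 0) : LieAlg G) +
        t • (Θ (extChartAt (𝓡 2) p q) (e 1) : LieAlg G) = 0 → s = 0 ∧ t = 0 := by
    intro q hq s t hst
    have h0 : Θ (extChartAt (𝓡 2) p q) (s • e 0 + t • e 1) = Θ (extChartAt (𝓡 2) p q) 0 := by
      rw [map_add, map_smul, map_smul, map_zero]
      exact hst
    have h1 := mcForm_inChart_injective hφ hq h0
    constructor
    · simpa [e] using congrArg (fun u : EuclideanSpace ℝ (Fin 2) => u 0) h1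
    · simpa [e] using congrArg (fun u : EuclideanSpace ℝ (Fin 2) => u 1) h1
  have hcont : ∀ i j, ContinuousAt (fun q => modelCoord E i (Θ (extChartAt (𝓡 2) p q) (e j))) p := by
    intro i j
    have h1 : ContinuousAt Θ (extChartAt (𝓡 2) p p) :=
      (contDiffAt_mcForm (contMDiffAt_inChart hφ.contMDiff
        ((extChartAt (𝓡 2) p).map_source hp))).continuousAt
    have h2 : ContinuousAt (fun q => Θ (extChartAt (𝓡 2) p q)) p :=
      ContinuousAt.comp (g := Θ) h1 (continuousAt_extChartAt (I := 𝓡 2) p)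
    exact (modelCoord E i).continuous.continuousAt.comp (h2.clm_apply continuousAt_const)
  refine ⟨_, ?_, (eventually_of_mem ((isOpen_extChartAt_source (I := 𝓡 2) p).mem_nhds hp)
    fun q hq => (hspan q hq) ▸ isNormal_span_pair E (hind q hq))⟩
  rw [continuousAt_pi]
  intro i
  fin_cases i
  · exact ((hcont 1 0).mul (hcont 2 1)).sub ((hcont 2 0).mul (hcont 1 1))
  · exact ((hcont 2 0).mul (hcont 0 1)).sub ((hcont 0 0).mul (hcont 2 1))
  · exact ((hcont 0 0).mul (hcont 1 1)).sub ((hcont 1 0).mul (hcont 0 1))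

end Surfaces

/-! ### One-parameter subgroups and construction of integral surfaces. -/

section OneParameter

/-- Solutions of a smooth autonomous ODE are smooth. -/
theorem contDiffAt_of_hasDerivAt_comp {W : Type*} [NormedAddCommGroup W] [NormedSpace ℝ W]
    {f : W → W} {η : ℝ → W} {t₀ : ℝ} (hf : ContDiffAt ℝ ∞ f (η t₀))
    (hη : ∀ᶠ t in 𝓝 t₀, HasDerivAt η (f (η t)) t) : ContDiffAt ℝ ∞ η t₀ := by
  rw [contDiffAt_infty]
  intro n
  induction n with
  | zero =>
    rw [Nat.cast_zero, contDiffAt_zero]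
    exact ⟨_, hη, fun t ht => ht.continuousAt.continuousWithinAt⟩
  | succ n ih =>
    rw [Nat.cast_succ, contDiffAt_succ_iff_hasFDerivAt]
    refine ⟨fun t => ContinuousLinearMap.toSpanSingleton ℝ (f (η t)), ⟨_, hη, fun t ht => ?_⟩, ?_⟩
    · exact HasDerivAt.hasFDerivAt ht
    · have h1 : ContDiffAt ℝ n (fun t => f (η t)) t₀ :=
        ContDiffAt.comp (g := f) t₀ (hf.of_le (by exact_mod_cast le_top)) ih
      exact (ContinuousLinearMap.toSpanSingletonCLE (𝕜 := ℝ) (E := W)).contDiff.contDiffAt.comp t₀ h1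

variable {G : Type*} [TopologicalSpace G] [ChartedSpace (EuclideanSpace ℝ (Fin 3)) G] [Group G]

theorem mcForm_comp {V V' : Type*} [NormedAddCommGroup V] [NormedSpace ℝ V]
    [NormedAddCommGroup V'] [NormedSpace ℝ V'] {φ : V' → G} {l : V → V'} {x : V} {l' : V →L[ℝ] V'}
    (hφ : MDifferentiableAt 𝓘(ℝ, V') (𝓡 3) φ (l x)) (hl : HasFDerivAt l l' x) (u : V) :
    mcForm (fun y => φ (l y)) x u = mcForm φ (l x) (l' u) := by
  have h3 := (hφ.hasMFDerivAt.comp x hl.hasMFDerivAt).mfderiv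
  have h4 : mcForm (fun y => φ (l y)) x u =
    leftTriv (φ (l x)) (mfderiv 𝓘(ℝ, V) (𝓡 3) (φ ∘ l) x u) := rfl
  rw [h4, h3]
  rfl

variable [LieGroup (𝓡 3) ∞ G]

theorem mfderiv_mul_left_mulInvariantVectorField (a g : G) (z : LieAlg G) :
    mfderiv (𝓡 3) (𝓡 3) (fun h : G => a * h) g (mulInvariantVectorField z g) =
      mulInvariantVectorField z (a * g) := by
  have h1 : MDifferentiableAt (𝓡 3) (𝓡 3) (fun h : G => g * h) 1 :=
    (contMDiff_mul_left (I := 𝓡 3) (n := ∞)).mdifferentiableAt (by simp)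
  have h2 : MDifferentiableAt (𝓡 3) (𝓡 3) (fun h : G => a * h) (g * 1) :=
    (contMDiff_mul_left (I := 𝓡 3) (n := ∞)).mdifferentiableAt (by simp)
  have h3 := mfderiv_comp_apply 1 h2 h1 z
  have h4 : (fun h : G => a * h) ∘ (fun h : G => g * h) = fun h => a * g * h := by
    ext; simp [mul_assoc]
  rw [h4, mul_one] at h3
  exact h3.symm

/-- Charts make G a T1 space, and a T1 topological group is Hausdorff. Global existence of integral
curves relies on this. -/
theorem t2Space_of_lieGroup (G : Type*) [TopologicalSpace G]
    [ChartedSpace (EuclideanSpace ℝ (Fin 3)) G] [Group G] [LieGroup (𝓡 3) ∞ G] : T2Space G := by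
  have := topologicalGroup_of_lieGroup (𝓡 3) ∞ (G := G)
  have := ChartedSpace.t1Space (EuclideanSpace ℝ (Fin 3)) G
  infer_instance

/-- Left translates of one local integral curve through 1 exist for the same time at every point,
and a uniform existence time makes the field complete. -/
theorem exists_isMIntegralCurve_mulInvariantVectorField (z : LieAlg G) :
    ∃ γ : ℝ → G, γ 0 = 1 ∧ IsMIntegralCurve (I := 𝓡 3) γ (mulInvariantVectorField z) := by
  have := t2Space_of_lieGroup G
  have hv : ContMDiff (𝓡 3) (𝓡 3).tangent 1
      (fun g : G => (⟨g, mulInvariantVectorField z g⟩ : TangentBundle (𝓡 3) G)) :=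
    (contMDiff_mulInvariantVectorField_infty z).of_le (by simp)
  obtain ⟨γ, hγ0, hγ⟩ := exists_isMIntegralCurveAt_of_contMDiffAt_boundaryless (t₀ := 0)
    (hv.contMDiffAt (x := (1 : G)))
  obtain ⟨ε, hε, hγ⟩ := isMIntegralCurveAt_iff'.1 hγ
  rw [Real.ball_eq_Ioo, zero_sub, zero_add] at hγ
  refine exists_isMIntegralCurve_of_isMIntegralCurveOn hv hε (fun x => ?_) 1
  refine ⟨fun t => x * γ t, by simp [hγ0], fun t ht => ?_⟩
  have h2 : MDifferentiableAt (𝓡 3) (𝓡 3) (fun h : G => x * h) (γ t) :=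
    (contMDiff_mul_left (I := 𝓡 3) (n := ∞)).mdifferentiableAt (by simp)
  refine (h2.hasMFDerivAt.comp_hasMFDerivWithinAt t (hγ t ht)).congr_mfderiv ?_
  ext1
  change mfderiv (𝓡 3) (𝓡 3) (fun h : G => x * h) (γ t) ((1 : ℝ) • mulInvariantVectorField z (γ t)) =
    (1 : ℝ) • mulInvariantVectorField z (x * γ t)
  rw [one_smul, one_smul]
  exact mfderiv_mul_left_mulInvariantVectorField x (γ t) z

theorem mcForm_of_isMIntegralCurve {z : LieAlg G} {γ : ℝ → G}
    (hγ : IsMIntegralCurve (I := 𝓡 3) γ (mulInvariantVectorField z)) (t : ℝ) :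
    mcForm γ t 1 = z := by
  have h1 : mfderiv 𝓘(ℝ, ℝ) (𝓡 3) γ t 1 = mulInvariantVectorField z (γ t) := by
    rw [(hγ t).mfderiv]
    exact one_smul ℝ _
  have h2 : mcForm γ t 1 = leftTriv (γ t) (mfderiv 𝓘(ℝ, ℝ) (𝓡 3) γ t 1) := rfl
  rw [h2, h1]
  exact leftTriv_mulInvariantVectorField _ _

/-- In a chart the curve solves an autonomous equation with smooth right-hand side, so its
regularity bootstraps. -/
theorem contMDiff_of_isMIntegralCurve {z : LieAlg G} {γ : ℝ → G}
    (hγ : IsMIntegralCurve (I := 𝓡 3) γ (mulInvariantVectorField z)) :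
    ContMDiff 𝓘(ℝ, ℝ) (𝓡 3) ∞ γ := by
  intro t₀
  rw [contMDiffAt_iff_target]
  refine ⟨hγ.continuous.continuousAt, ?_⟩
  rw [contMDiffAt_iff_contDiffAt]
  refine contDiffAt_of_hasDerivAt_comp (f := chartField (γ t₀) z) (contDiffAt_chartField _ z) ?_
  have hsrc : ∀ᶠ t in 𝓝 t₀, γ t ∈ (extChartAt (𝓡 3) (γ t₀)).source :=
    hγ.continuous.continuousAt.eventually (extChartAt_source_mem_nhds (I := 𝓡 3) (γ t₀))
  filter_upwards [hsrc] with t ht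
  have h1 : MDifferentiableAt 𝓘(ℝ, ℝ) (𝓡 3) γ t := (hγ t).mdifferentiableAt
  have h2 := chartFrame_mcForm h1 ht 1
  rw [mcForm_of_isMIntegralCurve hγ] at h2
  have h3 : DifferentiableAt ℝ (extChartAt (𝓡 3) (γ t₀) ∘ γ) t :=
    mdifferentiableAt_iff_differentiableAt.1
      ((mdifferentiableAt_extChartAt (by simpa using ht)).comp t h1)
  have h4 := h3.hasDerivAt
  rw [← fderiv_apply_one_eq_deriv] at h4
  exact h4.congr_deriv (h2.symm.trans (chartFrame_apply _ _ _))

theorem mcForm_mul_left {V : Type*} [NormedAddCommGroup V] [NormedSpace ℝ V] {φ : V → G} {x : V}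
    (hφ : MDifferentiableAt 𝓘(ℝ, V) (𝓡 3) φ x) (a : G) :
    mcForm (fun y => a * φ y) x = mcForm φ x := by
  have h2 : MDifferentiableAt (𝓡 3) (𝓡 3) (fun h : G => a * h) (φ x) :=
    (contMDiff_mul_left (I := 𝓡 3) (n := ∞)).mdifferentiableAt (by simp)
  ext1 u
  have h3 := mfderiv_comp_apply x h2 hφ u
  have h4 : mcForm (fun y => a * φ y) x u =
    leftTriv (a * φ x) (mfderiv 𝓘(ℝ, V) (𝓡 3) ((fun h : G => a * h) ∘ φ) x u) := rfl
  rw [h4, h3, ← mulInvariantVectorField_mcForm φ x u]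
  exact (congrArg (leftTriv (a * φ x)) (mfderiv_mul_left_mulInvariantVectorField a (φ x) _)).trans
    (leftTriv_mulInvariantVectorField _ _)

/-- The adjoint action of `z` on the model space. -/
def modelAd (z : LieAlg G) : EuclideanSpace ℝ (Fin 3) →L[ℝ] EuclideanSpace ℝ (Fin 3) :=
  LinearMap.toContinuousLinearMap
    (LieAlgebra.ad ℝ (LieAlg G) z : EuclideanSpace ℝ (Fin 3) →ₗ[ℝ] EuclideanSpace ℝ (Fin 3))

/-- If `[Y, X] = l X`, then a map whose Maurer–Cartan form has image `span {X, Y}` passes through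
every point. It is `(s, t) ↦ g exp(sX) exp(tY)`. -/
theorem exists_map_mcForm_eq {X Y : EuclideanSpace ℝ (Fin 3)} {l : ℝ}
    (hXY : modelBracket G Y X = l • X)
    (hind : ∀ s t : ℝ, s • X + t • Y = 0 → s = 0 ∧ t = 0) (g : G) :
    ∃ φ : EuclideanSpace ℝ (Fin 2) → G, φ 0 = g ∧ ContMDiff (𝓡 2) (𝓡 3) ∞ φ ∧
      (∀ x, Function.Injective (mcForm φ x)) ∧
      (∀ x u, ∃ s t : ℝ, s • X + t • Y = mcForm φ x u) ∧
      ∀ x, ∀ s t : ℝ, ∃ u, mcForm φ x u = s • X + t • Y := by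
  obtain ⟨γ₁, hγ₁0, hγ₁⟩ := exists_isMIntegralCurve_mulInvariantVectorField (G := G) X
  obtain ⟨γ₂, hγ₂0, hγ₂⟩ := exists_isMIntegralCurve_mulInvariantVectorField (G := G) Y
  have hs₁ := contMDiff_of_isMIntegralCurve hγ₁
  have hs₂ := contMDiff_of_isMIntegralCurve hγ₂
  let φ : EuclideanSpace ℝ (Fin 2) → G := fun x => g * γ₁ (x 0) * γ₂ (x 1)
  let e : Fin 2 → EuclideanSpace ℝ (Fin 2) := EuclideanSpace.basisFun (Fin 2) ℝ
  have hcoord : ∀ i : Fin 2, ContMDiff (𝓡 2) 𝓘(ℝ, ℝ) ∞ (fun x : EuclideanSpace ℝ (Fin 2) => x i) :=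
    fun i => (EuclideanSpace.proj i : EuclideanSpace ℝ (Fin 2) →L[ℝ] ℝ).contMDiff
  have hφ : ContMDiff (𝓡 2) (𝓡 3) ∞ φ :=
    (contMDiff_const.mul (hs₁.comp (hcoord 0))).mul (hs₂.comp (hcoord 1))
  have hφd : ∀ x, MDifferentiableAt (𝓡 2) (𝓡 3) φ x := fun x => hφ.mdifferentiableAt (by simp)
  have hline : ∀ (i : Fin 2) (x : EuclideanSpace ℝ (Fin 2)) (t : ℝ),
      HasFDerivAt (fun t : ℝ => x + (t - x i) • e i) (ContinuousLinearMap.toSpanSingleton ℝ (e i))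
        t := by
    intro i x t
    have h1 : HasDerivAt (fun t : ℝ => x + (t - x i) • e i) ((1 : ℝ) • e i) t :=
      (((hasDerivAt_id t).sub_const (x i)).smul_const (e i)).const_add x
    rw [one_smul] at h1
    exact h1.hasFDerivAt
  have hself : ∀ (i : Fin 2) (x : EuclideanSpace ℝ (Fin 2)), x + (x i - x i) • e i = x := by simp
  have hY : ∀ x, mcForm φ x (e 1) = Y := by
    intro x
    have h1 := mcForm_comp (φ := φ) (hφd _) (hline 1 x (x 1)) 1
    rw [hself] at h1
    have h2 : (fun t : ℝ => φ (x + (t - x 1) • e 1)) = fun t => g * γ₁ (x 0) * γ₂ t := by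
      ext t; simp [φ, e]
    rw [h2, mcForm_mul_left (hs₂.mdifferentiableAt (by simp)),
      mcForm_of_isMIntegralCurve hγ₂] at h1
    rw [h1]; simp
  have hX0 : ∀ x : EuclideanSpace ℝ (Fin 2), x 1 = 0 → mcForm φ x (e 0) = X := by
    intro x hx
    have h1 := mcForm_comp (φ := φ) (hφd _) (hline 0 x (x 0)) 1
    rw [hself] at h1
    have h2 : (fun t : ℝ => φ (x + (t - x 0) • e 0)) = fun t => g * γ₁ t := by
      ext t; simp [φ, e, hx, hγ₂0]
    rw [h2, mcForm_mul_left (hs₁.mdifferentiableAt (by simp)),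
      mcForm_of_isMIntegralCurve hγ₁] at h1
    rw [h1]; simp
  have hsm : ∀ x, DifferentiableAt ℝ (mcForm φ) x := fun x =>
    (contDiffAt_mcForm (hφ x)).differentiableAt (by simp)
  -- Since Θ(e₁) is the constant Y, the structure equation loses one derivative and becomes a linear
  -- equation for Θ(e₀) along the second coordinate.
  have hderiv : ∀ x, fderiv ℝ (mcForm φ) x (e 1) (e 0) = -modelAd (G := G) Y (mcForm φ x (e 0)) := by
    intro x
    have h1 := fderiv_mcForm_sub (hφ x) (e 1) (e 0)
    have h2 : fderiv ℝ (mcForm φ) x (e 0) (e 1) = 0 := by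
      have h3 : HasFDerivAt (fun x => mcForm φ x (e 1)) _ x :=
        (hsm x).hasFDerivAt.clm_apply (hasFDerivAt_const (e 1) x)
      have h4 : (fun x => mcForm φ x (e 1)) = fun _ => Y :=
        funext hY
      rw [h4] at h3
      have h5 := congrArg (fun l => l (e 0)) (h3.unique (hasFDerivAt_const _ x))
      simpa using h5
    rw [h2, sub_zero, hY] at h1
    exact h1
  -- Θ(e₀) is Ad(exp(−tY))X with t = x 1, and X is an eigenvector of ad Y. Both sides solve the same
  -- linear equation and equal X where x 1 = 0, by `hX0`.
  have hX : ∀ x, mcForm φ x (e 0) = Real.exp (-l * x 1) • X := by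
    intro x
    have hf : ∀ t : ℝ, HasDerivAt (fun t : ℝ => mcForm φ (x + (t - x 1) • e 1) (e 0))
        (-modelAd (G := G) Y (mcForm φ (x + (t - x 1) • e 1) (e 0))) t := by
      intro t
      have h1 := ((hsm (x + (t - x 1) • e 1)).hasFDerivAt.comp t (hline 1 x t)).clm_apply
        (hasFDerivAt_const (e 0) t)
      have h2 := h1.hasDerivAt
      simpa [hderiv] using h2
    have hg : ∀ t : ℝ, HasDerivAt
        (fun t : ℝ => Real.exp (-l * t) • X)
        (-modelAd (G := G) Y (Real.exp (-l * t) • X)) t := by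
      intro t
      have h1 : HasDerivAt (fun t : ℝ => Real.exp (-l * t)) (Real.exp (-l * t) * (-l)) t := by
        simpa using ((hasDerivAt_id t).const_mul (-l)).exp
      have h2 : modelAd (G := G) Y X =
        l • X := hXY
      rw [map_smul, h2]
      have h3 := h1.smul_const X
      convert! h3 using 1
      module
    have huniq := ODE_solution_unique_univ (v := fun _ z => -modelAd (G := G) Y z) (s := fun _ => univ)
      (K := ‖-modelAd (G := G) Y‖₊) (t₀ := 0) (fun _ => (-modelAd (G := G) Y).lipschitz.lipschitzOnWith)
      (fun t => ⟨hf t, mem_univ _⟩) (fun t => ⟨hg t, mem_univ _⟩) (by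
        rw [hX0 _ (by simp [e])]; simp)
    have := congrFun huniq (x 1)
    simpa [hself] using this
  have hsum : ∀ u : EuclideanSpace ℝ (Fin 2), u = u 0 • e 0 + u 1 • e 1 := fun u => by
    have := (EuclideanSpace.basisFun (Fin 2) ℝ).sum_repr u
    rw [Fin.sum_univ_two] at this
    exact this.symm
  have hval : ∀ x u, mcForm φ x u =
      ((u 0 * Real.exp (-l * x 1)) • X + u 1 • Y) := by
    intro x u
    conv_lhs => rw [hsum u, map_add, map_smul, map_smul, hX, hY, smul_smul]
  have hinj : ∀ x, Function.Injective (mcForm φ x) := by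
    intro x u v huv
    rw [← sub_eq_zero, ← map_sub, hval] at huv
    obtain ⟨h0, h1⟩ := hind _ _ huv
    rw [← sub_eq_zero, hsum (u - v), h1, (mul_eq_zero.1 h0).resolve_right (Real.exp_pos _).ne']
    simp
  have hval' : ∀ (x : EuclideanSpace ℝ (Fin 2)) (s t : ℝ),
      mcForm φ x ((s * Real.exp (l * x 1)) • e 0 + t • e 1) = s • X + t • Y := by
    intro x s t
    rw [hval]
    simp [e, mul_assoc, ← Real.exp_add]
  exact ⟨φ, by simp [φ, hγ₁0, hγ₂0], hφ, hinj, fun x u => ⟨_, _, (hval x u).symm⟩,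
    fun x s t => ⟨_, hval' x s t⟩⟩

/-- The Euclidean plane as a surface. -/
def planeSurface : Surface.{0} where
  carrier := EuclideanSpace ℝ (Fin 2)

theorem exists_isIntegralSurface {X Y : LieAlg G} {l : ℝ} (hXY : ⁅Y, X⁆ = l • X)
    (hind : ∀ s t : ℝ, s • X + t • Y = 0 → s = 0 ∧ t = 0) (g : G) :
    ∃ (S : Surface.{0}) (φ : S.carrier → G) (p : S.carrier),
      φ p = g ∧ IsIntegralSurface (Submodule.span ℝ {X, Y}) φ := by
  obtain ⟨φ, hg, hφ, hinj, h1, h2⟩ := exists_map_mcForm_eq (X := X) (Y := Y) (l := l) hXY hind g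
  refine ⟨planeSurface, φ, (0 : EuclideanSpace ℝ (Fin 2)), hg, ⟨hφ, ?_⟩, ?_⟩
  · intro x u v huv
    exact hinj x (congrArg (leftTriv (φ x)) huv)
  · intro x
    ext z
    refine Iff.trans ?_ Submodule.mem_span_pair.symm
    constructor
    · rintro ⟨u, rfl⟩
      exact h1 x u
    · rintro ⟨s, t, rfl⟩
      exact h2 x s t

end OneParameter

/-! ### The planes of the distributions: bracket, metric and connection. -/

section DiagonalPlanes

variable {L : Type*} [LieRing L] [LieAlgebra ℝ L] {B : LinearMap.BilinForm ℝ L}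
  {E : Module.Basis (Fin 3) ℝ L} {ε c : Fin 3 → ℝ} {α β : ℝ}

/-- Relabeling of the basis; an odd permutation changes the sign of the structure constants. -/
theorem IsDiagonalBasis.exists_perm (h : IsDiagonalBasis B E ε c) (σ : Equiv.Perm (Fin 3)) :
    ∃ δ : ℝ, IsDiagonalBasis B (E.reindex σ.symm) (ε ∘ σ) (fun i => δ * c (σ i)) := by
  have h10 : ⁅E 1, E 0⁆ = -(c 2 • E 2) := by rw [← lie_skew, h.bracket_zero_one]
  have h21 : ⁅E 2, E 1⁆ = -(c 0 • E 0) := by rw [← lie_skew, h.bracket_one_two]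
  have h02 : ⁅E 0, E 2⁆ = -(c 1 • E 1) := by rw [← lie_skew, h.bracket_two_zero]
  have hσ : ∀ σ : Equiv.Perm (Fin 3),
      (σ 0 = 0 ∧ σ 1 = 1 ∧ σ 2 = 2 ∨ σ 0 = 1 ∧ σ 1 = 2 ∧ σ 2 = 0 ∨ σ 0 = 2 ∧ σ 1 = 0 ∧ σ 2 = 1) ∨
      (σ 0 = 1 ∧ σ 1 = 0 ∧ σ 2 = 2 ∨ σ 0 = 0 ∧ σ 1 = 2 ∧ σ 2 = 1 ∨ σ 0 = 2 ∧ σ 1 = 1 ∧ σ 2 = 0) := by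
    decide
  have key : ∃ δ : ℝ, ⁅E (σ 0), E (σ 1)⁆ = (δ * c (σ 2)) • E (σ 2) ∧
      ⁅E (σ 1), E (σ 2)⁆ = (δ * c (σ 0)) • E (σ 0) ∧
      ⁅E (σ 2), E (σ 0)⁆ = (δ * c (σ 1)) • E (σ 1) := by
    -- δ is the signature: even permutations first, then odd ones.
    rcases hσ σ with hσ | hσ
    · refine ⟨1, ?_⟩
      rcases hσ with ⟨e0, e1, e2⟩ | ⟨e0, e1, e2⟩ | ⟨e0, e1, e2⟩ <;>
        simp [e0, e1, e2, h.bracket_zero_one, h.bracket_one_two, h.bracket_two_zero]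
    · refine ⟨-1, ?_⟩
      rcases hσ with ⟨e0, e1, e2⟩ | ⟨e0, e1, e2⟩ | ⟨e0, e1, e2⟩ <;> simp [e0, e1, e2, h10, h21, h02]
  obtain ⟨δ, k0, k1, k2⟩ := key
  exact ⟨δ, fun i => h.sign _, fun i => by simpa using h.norm _,
    fun i j hij => by simpa using h.orthogonal _ _ fun e => hij (σ.injective e),
    by simpa using k0, by simpa using k1, by simpa using k2⟩

theorem mem_span_pair_iff (hα : α ≠ 0) (z : L) :
    z ∈ Submodule.span ℝ {α • E 0 + β • E 1, E 2} ↔ β * E.repr z 0 = α * E.repr z 1 := by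
  rw [Submodule.mem_span_pair]
  constructor
  · rintro ⟨s, t, rfl⟩
    simp
    ring
  · intro hz
    refine ⟨E.repr z 0 / α, E.repr z 2, ext_repr_fin_three E ?_ ?_ ?_⟩
    · simp [hα]
    · simp
      field_simp
      linear_combination hz
    · simp

theorem smul_add_smul_independent (hα : α ≠ 0) (s t : ℝ)
    (h : s • (α • E 0 + β • E 1) + t • E 2 = 0) : s = 0 ∧ t = 0 := by
  have h0 := congrArg (fun z => E.repr z 0) h
  have h2 := congrArg (fun z => E.repr z 2) h
  simp [hα] at h0 h2
  exact ⟨h0, h2⟩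

/-- The bracket is −βc₀E₀ + αc₁E₁; the quadratic relation is what makes it proportional to αE₀ +
βE₁. Hence the plane is a subalgebra. -/
theorem IsDiagonalBasis.lie_diag (h : IsDiagonalBasis B E ε c) (hα : α ≠ 0)
    (hαβ : c 0 * β ^ 2 + c 1 * α ^ 2 = 0) :
    ⁅E 2, α • E 0 + β • E 1⁆ = (-(β * c 0 / α)) • (α • E 0 + β • E 1) := by
  apply ext_repr_fin_three E
  · rw [h.repr_lie_zero]
    simp
    field_simp
  · rw [h.repr_lie_one]
    simp
    field_simp
    linear_combination hαβ
  · rw [h.repr_lie_two]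
    simp

theorem IsDiagonalBasis.form_diag_ne_zero_iff (h : IsDiagonalBasis B E ε c) (hα : α ≠ 0) :
    (∀ v ∈ Submodule.span ℝ {α • E 0 + β • E 1, E 2},
      (∀ w ∈ Submodule.span ℝ {α • E 0 + β • E 1, E 2}, B v w = 0) → v = 0) ↔
      ε 0 * α ^ 2 + ε 1 * β ^ 2 ≠ 0 := by
  constructor
  · intro hD h0
    have hU := hD (α • E 0 + β • E 1) (Submodule.subset_span (by simp)) (fun w hw => by
      rw [mem_span_pair_iff hα] at hw
      rw [h.form_eq]
      simp
      apply mul_left_cancel₀ hα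
      linear_combination E.repr w 0 * h0 - ε 1 * β * hw)
    have := congrArg (fun z => E.repr z 0) hU
    simp [hα] at this
  · intro h0 v hv hw
    obtain ⟨s, t, rfl⟩ := Submodule.mem_span_pair.1 hv
    have h1 := hw (α • E 0 + β • E 1) (Submodule.subset_span (by simp))
    have h2 := hw (E 2) (Submodule.subset_span (by simp))
    rw [h.form_eq] at h1 h2
    simp [h.sign_ne_zero] at h1 h2
    have h3 : s * (ε 0 * α ^ 2 + ε 1 * β ^ 2) = 0 := by linear_combination h1
    rw [(mul_eq_zero.1 h3).resolve_right h0, h2]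
    simp

/-- The vector z is arbitrary: since μ₂ = 0, only its E₂-component enters the E₀- and E₁-components
of ∇_w z, and hαβ places the result in the plane. Equivalently, by metric compatibility, the
left-invariant normal is parallel along the plane. -/
theorem IsDiagonalBasis.leviCivita_mem_diag [FiniteDimensional ℝ L] (h : IsDiagonalBasis B E ε c)
    (hB : B.Nondegenerate) (hα : α ≠ 0) (hαβ : c 0 * β ^ 2 + c 1 * α ^ 2 = 0)
    (hc : ε 2 * c 2 = ε 0 * c 0 + ε 1 * c 1) {w z : L}
    (hw : w ∈ Submodule.span ℝ {α • E 0 + β • E 1, E 2}) :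
    leviCivita B hB w z ∈ Submodule.span ℝ {α • E 0 + β • E 1, E 2} := by
  rw [mem_span_pair_iff hα] at hw ⊢
  have m0 : connCoeff ε c 0 = ε 1 * c 1 := by simp only [connCoeff]; linarith
  have m1 : connCoeff ε c 1 = ε 0 * c 0 := by simp only [connCoeff]; linarith
  have m2 : connCoeff ε c 2 = 0 := by simp only [connCoeff]; linarith
  rw [h.repr_leviCivita_zero, h.repr_leviCivita_one, m0, m1, m2]
  apply mul_left_cancel₀ hα
  linear_combination (-β * c 0 * E.repr z 2) * hw + (E.repr w 0 * E.repr z 2) * hαβ +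
    (β * c 0 * E.repr w 1 * E.repr z 2 * α) * h.sign_mul_self 0 +
    (α ^ 2 * c 1 * E.repr w 0 * E.repr z 2) * h.sign_mul_self 1

end DiagonalPlanes

theorem mul_mvfderiv_eq {M : Type*} [TopologicalSpace M]
    [ChartedSpace (EuclideanSpace ℝ (Fin 2)) M] {f g : M → ℝ} {p : M} {a b : ℝ}
    (hf : MDifferentiableAt (𝓡 2) 𝓘(ℝ, ℝ) f p) (hg : MDifferentiableAt (𝓡 2) 𝓘(ℝ, ℝ) g p)
    (h : ∀ᶠ q in 𝓝 p, a * f q = b * g q) (w : TangentSpace (𝓡 2) p) :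
    a * mvfderiv (𝓡 2) f p w = b * mvfderiv (𝓡 2) g p w := by
  have h1 : mvfderiv (𝓡 2) (fun q => a * f q) p = mvfderiv (𝓡 2) (fun q => b * g q) p := by
    simp only [mvfderiv]
    rw [Filter.EventuallyEq.mfderiv_eq h]
    rw [h.self_of_nhds]
    rfl
  rw [mvfderiv_fun_mul mdifferentiableAt_const hf, mvfderiv_fun_mul mdifferentiableAt_const hg] at h1
  simpa [mvfderiv_const] using DFunLike.congr_fun h1 w

variable {G : Type*} [TopologicalSpace G] [ChartedSpace (EuclideanSpace ℝ (Fin 3)) G] [Group G]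
  {S : Surface} {m : LeftInvariantMetric G}
  {E : Module.Basis (Fin 3) ℝ (LieAlg G)} {ε c : Fin 3 → ℝ} {σ : Equiv.Perm (Fin 3)} {s : ℝ}

theorem distribution_eq (E : Module.Basis (Fin 3) ℝ (LieAlg G)) (c : Fin 3 → ℝ)
    (σ : Equiv.Perm (Fin 3)) (s : ℝ) :
    distribution E c σ s = Submodule.span ℝ {√(-c (σ 0)) • E.reindex σ.symm 0 +
      (s * √(c (σ 1))) • E.reindex σ.symm 1, E.reindex σ.symm 2} := by
  simp [distribution]

variable [LieGroup (𝓡 3) ∞ G]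

theorem IsDiagonalFrame.isDiagonalBasis (h : IsDiagonalFrame m E ε c) :
    IsDiagonalBasis m.form E ε c :=
  ⟨h.sign, h.norm, h.orthogonal, h.bracket_zero_one, h.bracket_one_two, h.bracket_two_zero⟩

theorem sqrt_neg_ne_zero {x : ℝ} (hx : x < 0) : √(-x) ≠ 0 := (Real.sqrt_pos.2 (neg_pos.2 hx)).ne'

/-- The relation is homogeneous in c, so the factor δ introduced by a relabeling is harmless. -/
theorem Condition.mul_sq_add_mul_sq (h : Condition ε c σ) (hs : s = 1 ∨ s = -1) (δ : ℝ) :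
    δ * c (σ 0) * (s * √(c (σ 1))) ^ 2 + δ * c (σ 1) * √(-c (σ 0)) ^ 2 = 0 := by
  have hs2 : s ^ 2 = 1 := by rcases hs with rfl | rfl <;> norm_num
  rw [mul_pow, hs2, Real.sq_sqrt h.2.1.le, Real.sq_sqrt (neg_nonneg.2 h.2.2.le)]
  ring

/-- The tangent plane is constant, so a tangent field satisfies a linear equation with constant
coefficients, which its derivative inherits. The connection term is tangent by
`leviCivita_mem_diag`. -/
theorem IsIntegralSurface.isTotallyGeodesic (hE : IsDiagonalFrame m E ε c) (hσ : Condition ε c σ)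
    (hs : s = 1 ∨ s = -1) {φ : S.carrier → G} (hφ : IsIntegralSurface (distribution E c σ s) φ) :
    IsTotallyGeodesic m E φ := by
  obtain ⟨δ, hE'⟩ := hE.isDiagonalBasis.exists_perm σ
  have hα := sqrt_neg_ne_zero hσ.2.2
  intro p f hf hT w
  have hdiff : ∀ i, MDifferentiableAt (𝓡 2) 𝓘(ℝ, ℝ) (f i) p := fun i =>
    (hf i).mdifferentiableAt (by simp)
  have hw : leftDiff φ p w ∈ tangentPlane φ p := ⟨w, rfl⟩
  have hsum : covDeriv m E φ f p w = (∑ i, mvfderiv (𝓡 2) (f i) p w • E i) +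
      leviCivita m.form m.nondegenerate (leftDiff φ p w) (∑ i, f i p • E i) := by
    rw [covDeriv, Finset.sum_add_distrib, ← sum_repr_smul_leviCivita _ _ E _ (∑ i, f i p • E i)]
    simp only [E.repr_sum_self]
  rw [hφ.tangentPlane_eq, distribution_eq] at hw ⊢
  rw [hsum]
  refine Submodule.add_mem _ ?_ (hE'.leviCivita_mem_diag m.nondegenerate hα
    (hσ.mul_sq_add_mul_sq hs δ) (by simp only [Function.comp]; linear_combination δ * hσ.1) hw)
  rw [mem_span_pair_iff hα]
  simp only [Module.Basis.repr_reindex_apply, E.repr_sum_self, Equiv.symm_symm]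
  refine mul_mvfderiv_eq (hdiff _) (hdiff _) (hT.mono fun q hq => ?_) w
  rw [hφ.tangentPlane_eq, distribution_eq, mem_span_pair_iff hα] at hq
  simpa only [Module.Basis.repr_reindex_apply, E.repr_sum_self, Equiv.symm_symm] using hq

/-- Every totally geodesic surface is an integral surface. -/
theorem IsTotallyGeodesic.exists_isIntegralSurface (hE : IsDiagonalFrame m E ε c)
    (hK : ¬ HasConstantSectionalCurvature m) {φ : S.carrier → G}
    (hφ : IsNondegenerateImmersion m φ) (h : IsTotallyGeodesic m E φ) :
    ∃ σ, Condition ε c σ ∧ ∃ s : ℝ, (s = 1 ∨ s = -1) ∧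
      IsIntegralSurface (distribution E c σ s) φ := by
  obtain ⟨σ, hσ, s, hs, hT⟩ := hE.isDiagonalBasis.exists_eq_diagPlane
    (fun κ hκ => hK ⟨κ, hκ⟩) (h.isGeodesicPlaneField hφ) (hφ.toIsImmersion.exists_isNormal E)
  exact ⟨σ, hσ, s, hs, hφ.toIsImmersion, hT⟩

/-- The two spanning vectors are orthogonal and E (σ 2) is a unit vector, so only the norm of the
other one matters. It is ε (σ 1) * c (σ 1) − ε (σ 0) * c (σ 0), whatever the sign s. -/
theorem Condition.distribution_nondegenerate_iff (hE : IsDiagonalFrame m E ε c)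
    (hσ : Condition ε c σ) (hs : s = 1 ∨ s = -1) :
    (∀ v ∈ distribution E c σ s, (∀ w ∈ distribution E c σ s, m.form v w = 0) → v = 0) ↔
      ε (σ 0) * c (σ 0) ≠ ε (σ 1) * c (σ 1) := by
  obtain ⟨δ, hE'⟩ := hE.isDiagonalBasis.exists_perm σ
  have hs2 : s ^ 2 = 1 := by rcases hs with rfl | rfl <;> norm_num
  rw [distribution_eq, hE'.form_diag_ne_zero_iff (sqrt_neg_ne_zero hσ.2.2), mul_pow, hs2,
    Real.sq_sqrt hσ.2.1.le, Real.sq_sqrt (neg_nonneg.2 hσ.2.2.le), not_iff_not]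
  simp only [Function.comp]
  constructor <;> intro h <;> linarith

theorem IsIntegralSurface.nondegenerate_iff {D : Submodule ℝ (LieAlg G)} {φ : S.carrier → G}
    (hφ : IsIntegralSurface D φ) :
    IsNondegenerateImmersion m φ ↔ ∀ v ∈ D, (∀ w ∈ D, m.form v w = 0) → v = 0 := by
  constructor
  · intro h v hv hw
    obtain ⟨p⟩ := (inferInstance : Nonempty S.carrier)
    rw [← hφ.tangentPlane_eq p] at hv hw
    obtain ⟨v, rfl⟩ := hv
    have : v = 0 := h.nondegenerate p v fun w => hw _ ⟨w, rfl⟩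
    rw [this, map_zero]
  · refine fun h => ⟨hφ.toIsImmersion, fun p v hv => ?_⟩
    apply leftDiff_injective hφ.toIsImmersion p
    rw [map_zero]
    apply h
    · rw [← hφ.tangentPlane_eq p]
      exact ⟨v, rfl⟩
    · intro w hw
      rw [← hφ.tangentPlane_eq p] at hw
      obtain ⟨w, rfl⟩ := hw
      exact hv w

theorem Condition.exists_isIntegralSurface (hE : IsDiagonalFrame m E ε c) (hσ : Condition ε c σ)
    (hs : s = 1 ∨ s = -1) (g : G) :
    ∃ (S : Surface.{0}) (φ : S.carrier → G) (p : S.carrier),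
      φ p = g ∧ IsIntegralSurface (distribution E c σ s) φ := by
  obtain ⟨δ, hE'⟩ := hE.isDiagonalBasis.exists_perm σ
  have hα := sqrt_neg_ne_zero hσ.2.2
  rw [distribution_eq]
  exact MetricLie.exists_isIntegralSurface (hE'.lie_diag hα (hσ.mul_sq_add_mul_sq hs δ))
    (smul_add_smul_independent hα) g

end MetricLie

end

/-! ### Assembly of the three assertions. -/

theorem theorem3p16 {G : Type u} [TopologicalSpace G]
    [ChartedSpace (EuclideanSpace ℝ (Fin 3)) G] [Group G] [LieGroup (𝓡 3) ∞ G]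
    (m : MetricLie.LeftInvariantMetric G)
    (E : Module.Basis (Fin 3) ℝ (MetricLie.LieAlg G)) (ε c : Fin 3 → ℝ)
    (hE : MetricLie.IsDiagonalFrame m E ε c)
    (hK : ¬ MetricLie.HasConstantSectionalCurvature m) :
    -- existence of nondegenerate totally geodesic surfaces
    ((∃ (S : MetricLie.Surface.{0}) (φ : S.carrier → G),
        MetricLie.IsNondegenerateImmersion m φ ∧ MetricLie.IsTotallyGeodesic m E φ) ↔
      ∃ σ : Equiv.Perm (Fin 3), MetricLie.Condition ε c σ ∧
        ε (σ 0) * c (σ 0) ≠ ε (σ 1) * c (σ 1)) ∧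
    -- characterization of a given immersion
    (∀ (S : MetricLie.Surface.{w}) (φ : S.carrier → G),
      MetricLie.IsNondegenerateImmersion m φ →
        (MetricLie.IsTotallyGeodesic m E φ ↔
          ∃ σ : Equiv.Perm (Fin 3), MetricLie.Condition ε c σ ∧
            (MetricLie.IsIntegralSurface (MetricLie.distribution E c σ 1) φ ∨
              MetricLie.IsIntegralSurface (MetricLie.distribution E c σ (-1)) φ))) ∧
    -- for any admissible relabeling, the two distributions give all totally geodesic surfaces,
    -- and both are integrable: an integral surface passes through every point
    (∀ σ : Equiv.Perm (Fin 3), MetricLie.Condition ε c σ →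
      (∀ (S : MetricLie.Surface.{w}) (φ : S.carrier → G),
        MetricLie.IsNondegenerateImmersion m φ →
          (MetricLie.IsTotallyGeodesic m E φ ↔
            MetricLie.IsIntegralSurface (MetricLie.distribution E c σ 1) φ ∨
              MetricLie.IsIntegralSurface (MetricLie.distribution E c σ (-1)) φ)) ∧
      ∀ s : ℝ, s = 1 ∨ s = -1 → ∀ g : G,
        ∃ (S : MetricLie.Surface.{0}) (φ : S.carrier → G) (p : S.carrier),
          φ p = g ∧ MetricLie.IsIntegralSurface (MetricLie.distribution E c σ s) φ) := by
  refine ⟨⟨?_, ?_⟩, fun S φ hφ => ⟨?_, ?_⟩, fun σ hσ => ⟨fun S φ hφ => ⟨?_, ?_⟩, ?_⟩⟩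
  · rintro ⟨S, φ, hφ, hT⟩
    obtain ⟨σ, hσ, s, hs, hI⟩ := hT.exists_isIntegralSurface hE hK hφ
    exact ⟨σ, hσ, (hσ.distribution_nondegenerate_iff hE hs).1 (hI.nondegenerate_iff.1 hφ)⟩
  · rintro ⟨σ, hσ, hne⟩
    obtain ⟨S, φ, p, -, hI⟩ := hσ.exists_isIntegralSurface hE (Or.inl rfl) 1
    exact ⟨S, φ, hI.nondegenerate_iff.2 ((hσ.distribution_nondegenerate_iff hE (Or.inl rfl)).2 hne),
      hI.isTotallyGeodesic hE hσ (Or.inl rfl)⟩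
  · intro hT
    obtain ⟨σ, hσ, s, rfl | rfl, hI⟩ := hT.exists_isIntegralSurface hE hK hφ
    · exact ⟨σ, hσ, Or.inl hI⟩
    · exact ⟨σ, hσ, Or.inr hI⟩
  · rintro ⟨σ, hσ, hI | hI⟩
    · exact hI.isTotallyGeodesic hE hσ (Or.inl rfl)
    · exact hI.isTotallyGeodesic hE hσ (Or.inr rfl)
  · intro hT
    obtain ⟨τ, hτ, s, hs, hI⟩ := hT.exists_isIntegralSurface hE hK hφ
    -- The classification produces some relabeling τ; uniqueness identifies it with the given σ.
    obtain rfl := hσ.unique hτ hE.isDiagonalBasis.sign_ne_zero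
    rcases hs with rfl | rfl
    · exact Or.inl hI
    · exact Or.inr hI
  · rintro (hI | hI)
    · exact hI.isTotallyGeodesic hE hσ (Or.inl rfl)
    · exact hI.isTotallyGeodesic hE hσ (Or.inr rfl)
  · exact fun s hs g => hσ.exists_isIntegralSurface hE hs g
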